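/- Let $\mathrm{ZF}$ be the classical first-order theory with equality in the language $\{\in\}$ with the axioms of extensionality, separation, pairing, union, power set, replacement, infinity and foundation. The syntactic category $\mathbb{ZF}$ has as objects the formulas in context $\{x_1,\dots,x_n\mid P\}$ ($n\ge 0$, the free variables of $P$ being among the distinct variables $x_1,\dots,x_n$; names of context variables are immaterial). An arrow $\{\mathbf x\mid P\}\to\{\mathbf y\mid Q\}$ is a class $[\{\mathbf x,\mathbf y\mid F\}]_\equiv$ of formulas with $F\vdash_{ZF}P\wedge Q$, $\;F\wedge F[\mathbf y'/\mathbf y]\vdash_{ZF}\mathbf y=\mathbf y'$ and $P\vdash_{ZF}\exists\mathbf y\,F$, where $F\equiv F'$ iff $\vdash_{ZF}F\leftrightarrow F'$. The identity of $\{\mathbf x\mid P\}$ is $[\{\mathbf x,\mathbf x'\mid \mathbf x=\mathbf x'\wedge P\}]_\equiv$, and the composite of $[\{\mathbf x,\mathbf y\mid F\}]_\equiv$ and $[\{\mathbf y,\mathbf z\mid G\}]_\equiv$ is $[\{\mathbf x,\mathbf z\mid\exists\mathbf y(F\wedge G)\}]_\equiv$. An internal category of a category $\mathbb C$ consists of objects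 $C_0,C_1$ and arrows $\delta_0,\delta_1:C_1\to C_0$, $ID:C_0\to C_1$, $\Box:C_2\to C_1$, where $C_2$, with projections $p_0,p_1:C_2\to C_1$, is a pullback of $\delta_1$ and $\delta_0$ (so $\delta_1p_0=\delta_0p_1$), such that, writing $\lceil f,f'\rceil$ for the arrow into a pullback with components $f,f'$, 1. $\delta_0\circ ID=\delta_1\circ ID=\mathrm{id}_{C_0}$; 2. $\delta_0\circ\Box=\delta_0\circ p_0$ and $\delta_1\circ\Box=\delta_1\circ p_1$; 3. $\Box\circ\lceil ID\circ\delta_0,\mathrm{id}_{C_1}\rceil=\Box\circ\lceil \mathrm{id}_{C_1},ID\circ\delta_1\rceil=\mathrm{id}_{C_1}$; 4. the pullback $C_3$ of $\delta_1\circ\Box$ and $\delta_0$ exists, and, with its projections $q_0:C_3\to C_2$ and $q_1:C_3\to C_1$, $\;\Box\circ\lceil\Box\circ q_0,q_1\rceil=\Box\circ\lceil p_0\circ q_0,\Box\circ\lceil p_1\circ q_0,q_1\rceil\rceil:C_3\to C_1$. Let $\langle a,b\rangle=\{\{a\},\{a,b\}\}$, let $Fun(f)$ say that $f$ is a single-valued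 set of ordered pairs, and let $dom(f)$, $ran(f)$ be the sets of first and of second components of the pairs in $f$. **Theorem.** The following formulas define objects and arrows of $\mathbb{ZF}$, and $(\mathcal{SET}_0,\mathcal{SET}_1,\delta_0,\delta_1,ID,\Box)$ is an internal category of $\mathbb{ZF}$: - $\mathcal{SET}_0=\{x\mid x=x\}$; - $\mathcal{SET}_1=\{F\mid\exists f\exists z(F=\langle f,z\rangle\wedge Fun(f)\wedge ran(f)\subseteq z)\}$; - $\delta_0=[\{F,x\mid\exists f\exists z(F=\langle f,z\rangle\wedge Fun(f)\wedge ran(f)\subseteq z\wedge dom(f)=x)\}]_\equiv:\mathcal{SET}_1\to\mathcal{SET}_0$; - $\delta_1=[\{F,z\mid\exists f(F=\langle f,z\rangle\wedge Fun(f)\wedge ran(f)\subseteq z)\}]_\equiv:\mathcal{SET}_1\to\mathcal{SET}_0$; - $ID=[\{x,F\mid\exists f(F=\langle f,x\rangle\wedge\forall t(t\in f\leftrightarrow\exists s(s\in x\wedge t=\langle s,s\rangle)))\}]_\equiv:\mathcal{SET}_0\to\mathcal{SET}_1$; - the object of composable arrows is $\mathcal{SET}_2=\{J\mid\exists f\exists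 f'\exists z\,K(J,f,f',z)\}$, where $K(J,f,f',z)$ is $J=\langle f,\langle f',z\rangle\rangle\wedge Fun(f)\wedge Fun(f')\wedge ran(f)\subseteq dom(f')\wedge ran(f')\subseteq z$, with the projections $p_0=[\{J,F\mid\exists f\exists f'\exists z(K(J,f,f',z)\wedge F=\langle f,dom(f')\rangle)\}]_\equiv$ and $p_1=[\{J,F\mid\exists f\exists f'\exists z(K(J,f,f',z)\wedge F=\langle f',z\rangle)\}]_\equiv$ to $\mathcal{SET}_1$; - $\Box=[\{J,G\mid\exists f\exists f'\exists z\exists f''(K(J,f,f',z)\wedge G=\langle f'',z\rangle\wedge\forall t(t\in f''\leftrightarrow\exists s\exists s'\exists s''(\langle s,s'\rangle\in f\wedge\langle s',s''\rangle\in f'\wedge t=\langle s,s''\rangle)))\}]_\equiv:\mathcal{SET}_2\to\mathcal{SET}_1$. -/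

import Mathlib

open CategoryTheory CategoryTheory.Limits
open scoped FirstOrder

namespace ZFSyn

/-! ### The language of set theory and its formulas -/

/-- The only non-logical symbol of set theory: the binary relation symbol of membership. -/
inductive MemRel : ℕ → Type
  | mem : MemRel 2

/-- The first-order language of set theory: no function symbols, one binary relation symbol. -/
def setLang : FirstOrder.Language.{0, 0} :=
  ⟨fun _ => Empty, MemRel⟩

/-- Formulas of set theory in a context of `n` variables. The variables in context are numbered
`0, …, n - 1`; a quantifier in front of a formula in context `n + 1` binds the variable number `n`,
and the other variables keep their numbers. -/
abbrev Fml (n : ℕ) : Type := setLang.BoundedFormula Empty n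

/-- The atomic formula `vᵢ = vⱼ`. -/
def eq {n : ℕ} (i j : Fin n) : Fml n :=
  .equal (.var (Sum.inr i)) (.var (Sum.inr j))

/-- The atomic formula `vᵢ ∈ vⱼ`. -/
def mem {n : ℕ} (i j : Fin n) : Fml n :=
  .rel MemRel.mem ![.var (Sum.inr i), .var (Sum.inr j)]

/-- Extension of a map of variables below a quantifier: the bound variable goes to the bound
variable. -/
def lift {n m : ℕ} (ρ : Fin n → Fin m) : Fin (n + 1) → Fin (m + 1) :=
  Fin.snoc (α := fun _ => Fin (m + 1)) (fun i => (ρ i).castSucc) (Fin.last m)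

/-- Simultaneous (capture-avoiding) substitution of variables for variables: `ren ρ φ` is
`φ[v_{ρ 0}, v_{ρ 1}, … / v₀, v₁, …]`. The language has no function symbols, so that variables are
the only terms. -/
def ren : {n m : ℕ} → (Fin n → Fin m) → Fml n → Fml m
  | _, _, _, .falsum => .falsum
  | _, _, ρ, .equal t s => .equal (t.relabel (Sum.map id ρ)) (s.relabel (Sum.map id ρ))
  | _, _, ρ, .rel R ts => .rel R (fun i => (ts i).relabel (Sum.map id ρ))
  | _, _, ρ, .imp φ ψ => .imp (ren ρ φ) (ren ρ ψ)
  | _, _, ρ, .all φ => .all (ren (lift ρ) φ)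

/-- `F(a, b)` for a formula `F` in a context that consists of two lists of variables. -/
def app {n m N : ℕ} (F : Fml (n + m)) (a : Fin n → Fin N) (b : Fin m → Fin N) : Fml N :=
  ren (Fin.append a b) F

/-- Existential quantification over the last `k` variables of the context. -/
def exs {n : ℕ} : (k : ℕ) → Fml (n + k) → Fml n
  | 0, φ => φ
  | k + 1, φ => exs k (∃' φ : Fml (n + k))

/-- Finite conjunctions. -/
def conj {N : ℕ} : (k : ℕ) → (Fin k → Fml N) → Fml N
  | 0, _ => ⊤
  | k + 1, f => conj k (fun i => f i.castSucc) ⊓ f (Fin.last k)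

/-- Equality of two lists of variables of the same length. -/
def tupEq {m N : ℕ} (a b : Fin m → Fin N) : Fml N :=
  conj m (fun i => eq (a i) (b i))

/-! ### Derivability in classical first-order logic with equality -/

/-- `Der T Γ φ`: natural deduction for classical first-order logic with equality over the set `T` of
axioms, where `Γ` is the set of assumptions and all free variables are among the variables
in context. As usual in classical logic the domain of discourse is not empty (rule `inhab`). -/
inductive Der (T : setLang.Theory) : {n : ℕ} → Set (Fml n) → Fml n → Prop
  | axm {n : ℕ} {Γ : Set (Fml n)} {φ : setLang.Sentence} :
      φ ∈ T → Der T Γ (ren (fun i => i.elim0) φ)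
  | hyp {n : ℕ} {Γ : Set (Fml n)} {φ : Fml n} : φ ∈ Γ → Der T Γ φ
  | impI {n : ℕ} {Γ : Set (Fml n)} {φ ψ : Fml n} : Der T (insert φ Γ) ψ → Der T Γ (φ ⟹ ψ)
  | impE {n : ℕ} {Γ : Set (Fml n)} {φ ψ : Fml n} : Der T Γ (φ ⟹ ψ) → Der T Γ φ → Der T Γ ψ
  | raa {n : ℕ} {Γ : Set (Fml n)} {φ : Fml n} : Der T (insert (∼φ) Γ) ⊥ → Der T Γ φ
  | allI {n : ℕ} {Γ : Set (Fml n)} {φ : Fml (n + 1)} :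
      Der T (ren Fin.castSucc '' Γ) φ → Der T Γ (∀' φ)
  | allE {n : ℕ} {Γ : Set (Fml n)} {φ : Fml (n + 1)} (i : Fin n) :
      Der T Γ (∀' φ) → Der T Γ (ren (Fin.snoc (α := fun _ => Fin n) id i) φ)
  | eqRefl {n : ℕ} {Γ : Set (Fml n)} (i : Fin n) : Der T Γ (eq i i)
  | eqSubst {n : ℕ} {Γ : Set (Fml n)} (φ : Fml (n + 1)) {i j : Fin n} : Der T Γ (eq i j) →
      Der T Γ (ren (Fin.snoc (α := fun _ => Fin n) id i) φ) →
      Der T Γ (ren (Fin.snoc (α := fun _ => Fin n) id j) φ)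
  | inhab {n : ℕ} {Γ : Set (Fml n)} : Der T Γ (∃' (eq (Fin.last n) (Fin.last n)))

/-! ### Set-theoretic shorthands

In each of them a numeral `i` is the variable `vᵢ`. -/

/-- `v₀ = ∅`. -/
def isEmpty : Fml 1 := ∀' ∼(mem 1 0)

/-- `v₀ ⊆ v₁`. -/
def subset : Fml 2 := ∀' (mem 2 0 ⟹ mem 2 1)

/-- `v₀ = {v₁, v₂}`. -/
def isUPair : Fml 3 := ∀' (mem 3 0 ⇔ (eq 3 1 ⊔ eq 3 2))

/-- `v₀ = v₁ ∪ {v₁}`. -/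
def isSucc : Fml 2 := ∀' (mem 2 0 ⇔ (mem 2 1 ⊔ eq 2 1))

/-- `v₀ = ⟨v₁, v₂⟩ = {{v₁}, {v₁, v₂}}`. -/
def isPair : Fml 3 :=
  ∃' ∃' (ren ![3, 1, 1] isUPair ⊓ ren ![4, 1, 2] isUPair ⊓ ren ![0, 3, 4] isUPair)

/-- `⟨v₀, v₁⟩ ∈ v₂`. -/
def pairMem : Fml 3 := ∃' (ren ![3, 0, 1] isPair ⊓ mem 3 2)

/-- `Fun(v₀)`: `v₀` is a set of ordered pairs, and it is single-valued. -/
def isFun : Fml 1 :=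
  (∀' (mem 1 0 ⟹ ∃' ∃' (ren ![1, 2, 3] isPair))) ⊓
    ∀' ∀' ∀' ((ren ![1, 2, 0] pairMem ⊓ ren ![1, 3, 0] pairMem) ⟹ eq 2 3)

/-- `dom(v₀) = v₁`. -/
def isDom : Fml 2 := ∀' (mem 2 1 ⇔ ∃' (ren ![2, 3, 0] pairMem))

/-- `ran(v₀) ⊆ v₁`. -/
def ranSub : Fml 2 := ∀' (∃' (ren ![3, 2, 0] pairMem) ⟹ mem 2 1)

/-- `ran(v₀) ⊆ dom(v₁)`. -/
def ranSubDom : Fml 2 := ∀' (∃' (ren ![3, 2, 0] pairMem) ⟹ ∃' (ren ![2, 3, 1] pairMem))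

/-- `v₀ = ⟨v₁, ⟨v₂, v₃⟩⟩`. -/
def isTriple : Fml 4 := ∃' (ren ![4, 2, 3] isPair ⊓ ren ![0, 1, 4] isPair)

/-! ### The axioms of ZF -/

/-- Extensionality. -/
def axExt : setLang.Sentence := ∀' ∀' (∀' (mem 2 0 ⇔ mem 2 1) ⟹ eq (n := 2) 0 1)

/-- Separation for the formula `P`, whose free variables are the parameters `v₀, …, v_{k-1}` and
`t = v_k`. In the axiom `x`, `y`, `t` have the numbers `k`, `k + 1`, `k + 2`. -/
def axSep {k : ℕ} (P : Fml (k + 1)) : setLang.Sentence :=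
  FirstOrder.Language.BoundedFormula.alls (n := k)
    (∀' ∃' ∀' (mem (n := k + 3) (Fin.natAdd k 2) (Fin.natAdd k 1) ⇔
      (mem (n := k + 3) (Fin.natAdd k 2) (Fin.natAdd k 0) ⊓
        app (N := k + 3) P (Fin.castAdd 3) ![Fin.natAdd k 2])))

/-- Pairing. -/
def axPair : setLang.Sentence :=
  ∀' ∀' ∃' ∀' (mem (n := 4) 3 2 ⇔ (eq 3 0 ⊔ eq 3 1))

/-- Union. -/
def axUnion : setLang.Sentence :=
  ∀' ∃' ∀' (mem (n := 3) 2 1 ⇔ ∃' (mem (n := 4) 2 3 ⊓ mem 3 0))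

/-- Power set. -/
def axPower : setLang.Sentence :=
  ∀' ∃' ∀' (mem (n := 3) 2 1 ⇔ ren ![2, 0] subset)

/-- Replacement for the formula `F`, whose free variables are the parameters `v₀, …, v_{k-1}` and
`x = v_k`, `y = v_{k+1}`. In the axiom `z` has the number `k`; in the premise `x`, `y`, `y'` have
the numbers `k + 1`, `k + 2`, `k + 3`, and in the conclusion `z'`, `x`, `y` have these numbers. -/
def axRepl {k : ℕ} (F : Fml (k + 2)) : setLang.Sentence :=
  FirstOrder.Language.BoundedFormula.alls (n := k)
    (∀' (
      ∀' (mem (n := k + 2) (Fin.natAdd k 1) (Fin.natAdd k 0) ⟹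
        ∃' (app (N := k + 3) F (Fin.castAdd 3) ![Fin.natAdd k 1, Fin.natAdd k 2] ⊓
          ∀' (app (N := k + 4) F (Fin.castAdd 4) ![Fin.natAdd k 1, Fin.natAdd k 3] ⟹
            eq (n := k + 4) (Fin.natAdd k 3) (Fin.natAdd k 2)))) ⟹
      ∃' ∀' (mem (n := k + 3) (Fin.natAdd k 2) (Fin.natAdd k 0) ⟹
        ∃' (mem (n := k + 4) (Fin.natAdd k 3) (Fin.natAdd k 1) ⊓
          app (N := k + 4) F (Fin.castAdd 4) ![Fin.natAdd k 2, Fin.natAdd k 3]))))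

/-- Infinity: `∃ x (∅ ∈ x ∧ ∀ t (t ∈ x → t ∪ {t} ∈ x))`. -/
def axInf : setLang.Sentence :=
  ∃' (∃' (ren ![1] isEmpty ⊓ mem (n := 2) 1 0) ⊓
    ∀' (mem (n := 2) 1 0 ⟹ ∃' (ren ![2, 1] isSucc ⊓ mem (n := 3) 2 0)))

/-- Foundation. -/
def axFound : setLang.Sentence :=
  ∀' (∼(ren ![0] isEmpty) ⟹
    ∃' (mem (n := 2) 1 0 ⊓ ∀' (mem (n := 3) 2 0 ⟹ ∼(mem 2 1))))

/-- The axioms of ZF. -/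
inductive IsZFAxiom : setLang.Sentence → Prop
  | ext : IsZFAxiom axExt
  | sep {k : ℕ} (P : Fml (k + 1)) : IsZFAxiom (axSep P)
  | pair : IsZFAxiom axPair
  | union : IsZFAxiom axUnion
  | power : IsZFAxiom axPower
  | repl {k : ℕ} (F : Fml (k + 2)) : IsZFAxiom (axRepl F)
  | inf : IsZFAxiom axInf
  | found : IsZFAxiom axFound

/-- The theory ZF. -/
def ZF : setLang.Theory := {φ | IsZFAxiom φ}

/-! ### Objects and arrows of the syntactic category of ZF -/

/-- The objects of the syntactic category: formulas in context `{x₁, …, xₙ | P}`. -/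
structure ZFCat : Type where
  /-- The length of the list of variables. -/
  arity : ℕ
  /-- The formula. -/
  fml : Fml arity

/-- The formula in context `{x, y | F}` defines an arrow from `{x | P}` to `{y | Q}`: it is, provably
in ZF, a functional relation. -/
structure IsArrow (X Y : ZFCat) (F : Fml (X.arity + Y.arity)) : Prop where
  /-- `F ⊢ P ∧ Q` -/
  typed : Der ZF {F} (ren (Fin.castAdd Y.arity) X.fml ⊓ ren (Fin.natAdd X.arity) Y.fml)
  /-- `F(x, y) ∧ F(x, y') ⊢ y = y'`, in the context `x, y, y'` -/
  single : Der ZF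
    {app F (Fin.castAdd Y.arity ∘ Fin.castAdd Y.arity) (Fin.castAdd Y.arity ∘ Fin.natAdd X.arity) ⊓
      app F (Fin.castAdd Y.arity ∘ Fin.castAdd Y.arity) (Fin.natAdd (X.arity + Y.arity))}
    (tupEq (Fin.castAdd Y.arity ∘ Fin.natAdd X.arity) (Fin.natAdd (X.arity + Y.arity)))
  /-- `P ⊢ ∃ y F` -/
  total : Der ZF {X.fml} (exs Y.arity F)

/-- The formula `x = y ∧ P(x)`, which defines the identity of `{x | P}`. -/
def idFml (X : ZFCat) : Fml (X.arity + X.arity) :=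
  tupEq (Fin.castAdd X.arity) (Fin.natAdd X.arity) ⊓ ren (Fin.castAdd X.arity) X.fml

/-- The formula `∃ y (F(x, y) ∧ G(y, z))`, which defines the composite of the arrows defined by `F`
and `G`; the context of the matrix is `x, z, y`. -/
def compFml {n m k : ℕ} (F : Fml (n + m)) (G : Fml (m + k)) : Fml (n + k) :=
  exs m (app F (Fin.castAdd m ∘ Fin.castAdd k) (Fin.natAdd (n + k)) ⊓
    app G (Fin.natAdd (n + k)) (Fin.castAdd m ∘ Fin.natAdd n))

/-! ### Auxiliary facts on substitution -/

theorem lift_comp {n m k : ℕ} (σ : Fin m → Fin k) (ρ : Fin n → Fin m) :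
    lift σ ∘ lift ρ = lift (σ ∘ ρ) := by
  funext i
  refine Fin.lastCases ?_ (fun i => ?_) i <;> simp [lift]

theorem lift_id {n : ℕ} : lift (id : Fin n → Fin n) = id := by
  funext i
  refine Fin.lastCases ?_ (fun i => ?_) i <;> simp [lift]

theorem ren_ren {n : ℕ} (φ : Fml n) : ∀ {m k : ℕ} (ρ : Fin n → Fin m) (σ : Fin m → Fin k),
    ren σ (ren ρ φ) = ren (σ ∘ ρ) φ := by
  induction φ with
  | falsum => intros; rfl
  | equal t s => intros; simp [ren, FirstOrder.Language.Term.relabel_relabel, Sum.map_comp_map]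
  | rel R ts => intros; simp [ren, FirstOrder.Language.Term.relabel_relabel, Sum.map_comp_map]
  | imp _ _ h1 h2 => intros; simp [ren, h1, h2]
  | all _ h => intros; simp [ren, h, lift_comp]

theorem ren_id {n : ℕ} (φ : Fml n) : ren id φ = φ := by
  induction φ with
  | falsum => rfl
  | equal t s => simp [ren]
  | rel R ts => simp [ren]
  | imp _ _ h1 h2 => simp [ren, h1, h2]
  | all _ h => simp [ren, h, lift_id]

theorem ren_imp {n m : ℕ} (ρ : Fin n → Fin m) (φ ψ : Fml n) :
    ren ρ (φ ⟹ ψ) = (ren ρ φ ⟹ ren ρ ψ) := rfl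
theorem ren_not {n m : ℕ} (ρ : Fin n → Fin m) (φ : Fml n) : ren ρ (∼φ) = ∼(ren ρ φ) := rfl
theorem ren_and {n m : ℕ} (ρ : Fin n → Fin m) (φ ψ : Fml n) :
    ren ρ (φ ⊓ ψ) = ren ρ φ ⊓ ren ρ ψ := rfl
theorem ren_ex {n m : ℕ} (ρ : Fin n → Fin m) (φ : Fml (n + 1)) :
    ren ρ (∃' φ) = ∃' (ren (lift ρ) φ) := rfl
theorem ren_eq {n m : ℕ} (ρ : Fin n → Fin m) (i j : Fin n) :
    ren ρ (eq i j) = eq (ρ i) (ρ j) := rfl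

theorem ren_mem {n m : ℕ} (ρ : Fin n → Fin m) (i j : Fin n) :
    ren ρ (mem i j) = mem (ρ i) (ρ j) := by
  simp only [ren, mem]
  congr 1
  funext k
  fin_cases k <;> rfl

theorem ren_conj {n m : ℕ} (ρ : Fin n → Fin m) : ∀ (k : ℕ) (f : Fin k → Fml n),
    ren ρ (conj k f) = conj k (fun i => ren ρ (f i))
  | 0, _ => rfl
  | k + 1, f => by simp only [conj, ren_and, ren_conj ρ k]

theorem ren_tupEq {m n N : ℕ} (ρ : Fin n → Fin N) (a b : Fin m → Fin n) :
    ren ρ (tupEq a b) = tupEq (ρ ∘ a) (ρ ∘ b) := by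
  simp only [tupEq, ren_conj, ren_eq]; rfl

theorem comp_append {n m N M : ℕ} (ρ : Fin N → Fin M) (a : Fin n → Fin N) (b : Fin m → Fin N) :
    ρ ∘ Fin.append a b = Fin.append (ρ ∘ a) (ρ ∘ b) := by
  funext i
  refine Fin.addCases (fun i => ?_) (fun i => ?_) i <;> simp

theorem ren_app {n m N M : ℕ} (F : Fml (n + m)) (ρ : Fin N → Fin M) (a : Fin n → Fin N)
    (b : Fin m → Fin N) : ren ρ (app F a b) = app F (ρ ∘ a) (ρ ∘ b) := by
  rw [app, ren_ren, comp_append, app]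

theorem append_castAdd_natAdd (n m : ℕ) :
    Fin.append (Fin.castAdd m : Fin n → _) (Fin.natAdd n) = id := by
  funext i
  refine Fin.addCases (fun i => ?_) (fun i => ?_) i <;> simp

theorem app_self {n m : ℕ} (F : Fml (n + m)) : app F (Fin.castAdd m) (Fin.natAdd n) = F := by
  rw [app, append_castAdd_natAdd, ren_id]

/-- Extension of a map of variables below `k` quantifiers. -/
def liftN {n m : ℕ} (k : ℕ) (ρ : Fin n → Fin m) : Fin (n + k) → Fin (m + k) :=
  Fin.append (Fin.castAdd k ∘ ρ) (Fin.natAdd m)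

theorem liftN_succ {n m : ℕ} (k : ℕ) (ρ : Fin n → Fin m) :
    liftN (k + 1) ρ = lift (liftN k ρ) := by
  funext i
  refine Fin.lastCases ?_ (fun i => ?_) i
  · have e : lift (liftN k ρ) (Fin.last (n + k)) = Fin.last (m + k) := by simp [lift]
    refine Eq.trans ?_ e.symm
    change Fin.append _ _ (Fin.natAdd n (Fin.last k)) = _
    rw [Fin.append_right]; rfl
  · simp only [lift, Fin.snoc_castSucc]
    refine Fin.addCases (fun i => ?_) (fun i => ?_) i
    · change Fin.append _ _ (Fin.castAdd (k + 1) i) = _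
      simp only [liftN, Fin.append_left]; rfl
    · change Fin.append _ _ (Fin.natAdd n i.castSucc) = _
      simp only [liftN, Fin.append_right]; rfl

theorem ren_exs {n m : ℕ} (ρ : Fin n → Fin m) : ∀ (k : ℕ) (φ : Fml (n + k)),
    ren ρ (exs k φ) = exs k (ren (liftN k ρ) φ)
  | 0, φ => by
    have : liftN 0 ρ = ρ := by
      funext i; exact Fin.append_left (m := n) (n := 0) _ _ i
    simp only [exs]; exact (congrArg (fun σ => ren σ φ) this).symm
  | k + 1, φ => by
    simp only [exs]
    rw [ren_exs ρ k, ren_ex, ← liftN_succ]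

/-! ### Auxiliary facts on derivability -/

theorem Der.weaken {T : setLang.Theory} {n : ℕ} {Γ : Set (Fml n)} {φ : Fml n} (h : Der T Γ φ) :
    ∀ {Δ : Set (Fml n)}, Γ ⊆ Δ → Der T Δ φ := by
  induction h with
  | axm h => exact fun _ => .axm h
  | hyp h => exact fun s => .hyp (s h)
  | impI _ ih => exact fun s => .impI (ih (Set.insert_subset_insert s))
  | impE _ _ ih1 ih2 => exact fun s => .impE (ih1 s) (ih2 s)
  | raa _ ih => exact fun s => .raa (ih (Set.insert_subset_insert s))
  | allI _ ih => exact fun s => .allI (ih (Set.image_mono s))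
  | allE i _ ih => exact fun s => .allE i (ih s)
  | eqRefl i => exact fun _ => .eqRefl i
  | eqSubst φ _ _ ih1 ih2 => exact fun s => .eqSubst φ (ih1 s) (ih2 s)
  | inhab => exact fun _ => .inhab

theorem comp_snoc_id {n m : ℕ} (ρ : Fin n → Fin m) (i : Fin n) :
    ρ ∘ Fin.snoc (α := fun _ => Fin n) id i =
      Fin.snoc (α := fun _ => Fin m) id (ρ i) ∘ lift ρ := by
  funext j
  refine Fin.lastCases ?_ (fun j => ?_) j <;> simp [lift]

theorem ren_inst {n m : ℕ} (ρ : Fin n → Fin m) (i : Fin n) (φ : Fml (n + 1)) :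
    ren ρ (ren (Fin.snoc (α := fun _ => Fin n) id i) φ) =
      ren (Fin.snoc (α := fun _ => Fin m) id (ρ i)) (ren (lift ρ) φ) := by
  rw [ren_ren, ren_ren, comp_snoc_id]

theorem lift_comp_castSucc {n m : ℕ} (ρ : Fin n → Fin m) :
    lift ρ ∘ Fin.castSucc = Fin.castSucc ∘ ρ := by
  funext i; simp [lift]

theorem Der.ren {T : setLang.Theory} {n : ℕ} {Γ : Set (Fml n)} {φ : Fml n} (h : Der T Γ φ) :
    ∀ {m : ℕ} (ρ : Fin n → Fin m), Der T (ren ρ '' Γ) (ren ρ φ) := by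
  induction h with
  | axm h =>
    intro m ρ
    rw [ren_ren]
    have : ∀ σ τ : Fin 0 → Fin m, σ = τ := fun σ τ => funext fun i => i.elim0
    rw [this (ρ ∘ _) (fun i => i.elim0)]
    exact .axm h
  | hyp h => exact fun ρ => .hyp (Set.mem_image_of_mem _ h)
  | impI _ ih => intro m ρ; have := ih ρ; rw [Set.image_insert_eq] at this; exact .impI this
  | impE _ _ ih1 ih2 => exact fun ρ => .impE (ih1 ρ) (ih2 ρ)
  | raa _ ih => intro m ρ; have := ih ρ; rw [Set.image_insert_eq] at this; exact .raa this
  | allI _ ih =>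
    intro m ρ
    refine .allI ?_
    have := ih (lift ρ)
    rw [Set.image_image] at this ⊢
    simpa only [ren_ren, lift_comp_castSucc] using this
  | allE i _ ih => intro m ρ; rw [ren_inst]; exact .allE _ (ih ρ)
  | eqRefl i => exact fun ρ => .eqRefl _
  | eqSubst φ _ _ ih1 ih2 =>
    intro m ρ
    have h2 := ih2 ρ
    rw [ren_inst] at h2 ⊢
    exact .eqSubst _ (ih1 ρ) h2
  | inhab =>
    intro m ρ
    rw [ren_ex, ren_eq]
    have : lift ρ (Fin.last _) = Fin.last m := by simp [lift]
    rw [this]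
    exact .inhab

section
variable {T : setLang.Theory} {n : ℕ} {Γ : Set (Fml n)} {φ ψ χ : Fml n}

theorem Der.cut (h : Der T Γ φ) (h' : Der T (insert φ Γ) ψ) : Der T Γ ψ := .impE (.impI h') h

theorem Der.cut1 (h : Der T Γ φ) (h' : Der T {φ} ψ) : Der T Γ ψ :=
  h.cut (h'.weaken (by simp))

theorem Der.exfalso (h : Der T Γ ⊥) : Der T Γ φ := .raa (h.weaken (Set.subset_insert _ _))

theorem Der.top : Der T Γ ⊤ := .impI (.hyp (Set.mem_insert _ _))

theorem Der.dne (h : Der T Γ (∼(∼φ))) : Der T Γ φ :=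
  .raa (.impE (h.weaken (Set.subset_insert _ _)) (.hyp (Set.mem_insert _ _)))

theorem Der.andI (h1 : Der T Γ φ) (h2 : Der T Γ ψ) : Der T Γ (φ ⊓ ψ) :=
  .impI (.impE (.impE (.hyp (Set.mem_insert _ _)) (h1.weaken (Set.subset_insert _ _)))
    (h2.weaken (Set.subset_insert _ _)))

theorem Der.andL (h : Der T Γ (φ ⊓ ψ)) : Der T Γ φ := by
  refine .raa (.impE (h.weaken (Set.subset_insert _ _)) (.impI (Der.exfalso ?_)))
  exact .impE (φ := φ) (.hyp (by simp [FirstOrder.Language.BoundedFormula.not])) (.hyp (by simp))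

theorem Der.andR (h : Der T Γ (φ ⊓ ψ)) : Der T Γ ψ := by
  refine .raa (.impE (h.weaken (Set.subset_insert _ _)) (.impI ?_))
  exact .hyp (by simp)

theorem Der.iffI (h1 : Der T (insert φ Γ) ψ) (h2 : Der T (insert ψ Γ) φ) : Der T Γ (φ ⇔ ψ) :=
  .andI (.impI h1) (.impI h2)

theorem Der.iffL (h : Der T Γ (φ ⇔ ψ)) (h' : Der T Γ φ) : Der T Γ ψ := .impE h.andL h'
theorem Der.iffR (h : Der T Γ (φ ⇔ ψ)) (h' : Der T Γ ψ) : Der T Γ φ := .impE h.andR h'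

theorem Der.exI {θ : Fml (n + 1)} (i : Fin n)
    (h : Der T Γ (ZFSyn.ren (Fin.snoc (α := fun _ => Fin n) id i) θ)) : Der T Γ (∃' θ) := by
  refine .impI (.impE (φ := ZFSyn.ren (Fin.snoc (α := fun _ => Fin n) id i) θ) ?_
    (h.weaken (Set.subset_insert _ _)))
  exact .allE (φ := ∼θ) i (.hyp (Set.mem_insert _ _))

theorem Der.exE {θ : Fml (n + 1)} (h : Der T Γ (∃' θ))
    (h' : Der T (insert θ (ZFSyn.ren Fin.castSucc '' Γ)) (ZFSyn.ren Fin.castSucc ψ)) :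
    Der T Γ ψ := by
  refine .raa (.impE (h.weaken (Set.subset_insert _ _)) (.allI (.impI ?_)))
  refine .impE (φ := ZFSyn.ren Fin.castSucc ψ) (.hyp ?_) (h'.weaken ?_)
  · exact Set.mem_insert_of_mem _ ⟨_, Set.mem_insert _ _, rfl⟩
  · exact Set.insert_subset_insert (Set.image_mono (Set.subset_insert _ _))

theorem Der.conjI : ∀ {k : ℕ} {f : Fin k → Fml n}, (∀ i, Der T Γ (f i)) → Der T Γ (conj k f)
  | 0, _, _ => .top
  | _ + 1, _, h => .andI (Der.conjI fun i => h i.castSucc) (h _)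

theorem Der.conjE : ∀ {k : ℕ} {f : Fin k → Fml n}, Der T Γ (conj k f) → ∀ i, Der T Γ (f i)
  | 0, _, _ => fun i => i.elim0
  | _ + 1, _, h => Fin.lastCases h.andR (Der.conjE h.andL)

theorem Der.exsI : ∀ {k : ℕ} {θ : Fml (n + k)} (b : Fin k → Fin n),
    Der T Γ (app θ id b) → Der T Γ (exs k θ)
  | 0, θ, b, h => by
    have : Fin.append (id : Fin n → Fin n) b = id := by
      funext i; exact Fin.append_left (m := n) (n := 0) _ _ i
    rw [app, this] at h
    exact (ren_id θ) ▸ h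
  | k + 1, θ, b, h => by
    refine Der.exsI (k := k) (fun i => b i.castSucc) ?_
    rw [app, ren_ex]
    refine .exI (b (Fin.last k)) ?_
    rw [ren_ren]
    convert h using 1
    rw [app]
    congr 1
    funext i
    refine Fin.lastCases ?_ (fun i => ?_) i
    · simp only [lift, Function.comp, Fin.snoc_last]
      exact (Fin.append_right (m := n) (n := k + 1) id b (Fin.last k)).symm
    · simp only [lift, Function.comp, Fin.snoc_castSucc, id]
      refine Fin.addCases (fun i => ?_) (fun i => ?_) i
      · rw [Fin.append_left]; exact (Fin.append_left (m := n) (n := k + 1) id b i).symm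
      · rw [Fin.append_right]
        exact (Fin.append_right (m := n) (n := k + 1) id b i.castSucc).symm

theorem Der.exsE : ∀ {k : ℕ} {θ : Fml (n + k)}, Der T Γ (exs k θ) →
    Der T (insert θ (ZFSyn.ren (Fin.castAdd k) '' Γ)) (ZFSyn.ren (Fin.castAdd k) ψ) → Der T Γ ψ
  | 0, θ, h, h' => by
    have e : (Fin.castAdd 0 : Fin n → Fin (n + 0)) = id := rfl
    have e2 : ZFSyn.ren (id : Fin n → Fin n) = id := funext ren_id
    rw [e] at h'
    erw [e2] at h'
    rw [Set.image_id] at h'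
    exact h.cut h'
  | k + 1, θ, h, h' => by
    refine Der.exsE (k := k) h ?_
    refine Der.exE (Der.hyp (Set.mem_insert _ _)) ?_
    rw [ren_ren]
    refine h'.weaken (Set.insert_subset_insert ?_)
    rintro _ ⟨χ, hχ, rfl⟩
    exact ⟨_, Set.mem_insert_of_mem _ ⟨χ, hχ, rfl⟩, ren_ren _ _ _⟩

theorem Der.eqSymm {i j : Fin n} (h : Der T Γ (eq i j)) : Der T Γ (eq j i) := by
  have := Der.eqSubst (eq (Fin.last n) i.castSucc) h (by
    rw [ren_eq]; simpa using Der.eqRefl i)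
  rw [ren_eq] at this
  simpa using this

theorem Der.eqTrans {i j k : Fin n} (h : Der T Γ (eq i j)) (h' : Der T Γ (eq j k)) :
    Der T Γ (eq i k) := by
  have := Der.eqSubst (eq i.castSucc (Fin.last n)) h' (by
    rw [ren_eq]; simpa using h)
  rw [ren_eq] at this
  simpa using this

theorem Der.renUpdate {N : ℕ} (θ : Fml N) (a : Fin N → Fin n) (i : Fin N) {j : Fin n}
    (h : Der T Γ (eq (a i) j)) (h' : Der T Γ (ZFSyn.ren a θ)) :
    Der T Γ (ZFSyn.ren (Function.update a i j) θ) := by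
  have := Der.eqSubst
    (ZFSyn.ren (Function.update (fun k => (a k).castSucc) i (Fin.last n)) θ) h (by
      rw [ren_ren]
      convert h'
      funext k
      by_cases hk : k = i
      · subst hk; simp
      · simp [Function.update_of_ne hk])
  rw [ren_ren] at this
  convert this
  funext k
  by_cases hk : k = i
  · subst hk; simp
  · simp [Function.update_of_ne hk]

theorem Der.renCongr {N : ℕ} (θ : Fml N) {a b : Fin N → Fin n}
    (h : ∀ i, Der T Γ (eq (a i) (b i))) (h' : Der T Γ (ZFSyn.ren a θ)) :
    Der T Γ (ZFSyn.ren b θ) := by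
  have key : ∀ s : Finset (Fin N), Der T Γ (ZFSyn.ren (s.piecewise b a) θ) := by
    intro s
    induction s using Finset.induction_on with
    | empty => simpa using h'
    | insert i s hi ih =>
      rw [Finset.piecewise_insert]
      refine Der.renUpdate θ _ i ?_ ih
      simpa [hi] using h i
  simpa using key Finset.univ

theorem Der.appCongr {p q : ℕ} (F : Fml (p + q)) {a a' : Fin p → Fin n} {b b' : Fin q → Fin n}
    (ha : Der T Γ (tupEq a a')) (hb : Der T Γ (tupEq b b')) (h : Der T Γ (app F a b)) :
    Der T Γ (app F a' b') := by
  refine Der.renCongr F (fun i => ?_) h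
  refine Fin.addCases (fun i => ?_) (fun i => ?_) i
  · simpa using ha.conjE i
  · simpa using hb.conjE i

theorem Der.tupRefl {q : ℕ} (a : Fin q → Fin n) : Der T Γ (tupEq a a) :=
  .conjI fun _ => .eqRefl _

theorem Der.tupSymm {q : ℕ} {a b : Fin q → Fin n} (h : Der T Γ (tupEq a b)) :
    Der T Γ (tupEq b a) := .conjI fun i => (h.conjE i).eqSymm

/-- Substitution into a derivation from one assumption. -/
theorem Der.subst {N : ℕ} {θ η : Fml N} (h : Der T {θ} η) (ρ : Fin N → Fin n)
    (h' : Der T Γ (ZFSyn.ren ρ θ)) : Der T Γ (ZFSyn.ren ρ η) := by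
  have := h.ren ρ
  rw [Set.image_singleton] at this
  exact h'.cut1 this

end

/-! ### The syntactic category of ZF -/

section
variable {X Y Z : ZFCat} {n : ℕ} {Γ : Set (Fml n)}

theorem IsArrow.src {F} (hF : IsArrow X Y F) {a : Fin X.arity → Fin n} {b : Fin Y.arity → Fin n}
    (h : Der ZF Γ (app F a b)) : Der ZF Γ (ren a X.fml) := by
  have := (Der.subst hF.typed (Fin.append a b) h).andL
  rw [ren_ren] at this
  convert this
  funext i; simp

theorem IsArrow.tgt {F} (hF : IsArrow X Y F) {a : Fin X.arity → Fin n} {b : Fin Y.arity → Fin n}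
    (h : Der ZF Γ (app F a b)) : Der ZF Γ (ren b Y.fml) := by
  have := (Der.subst hF.typed (Fin.append a b) h).andR
  rw [ren_ren] at this
  convert this
  funext i; simp

theorem IsArrow.uniq {F} (hF : IsArrow X Y F) {a : Fin X.arity → Fin n}
    {b b' : Fin Y.arity → Fin n} (h : Der ZF Γ (app F a b)) (h' : Der ZF Γ (app F a b')) :
    Der ZF Γ (tupEq b b') := by
  have e1 : Fin.append (Fin.append a b) b' ∘ Fin.castAdd Y.arity = Fin.append a b := by
    funext i; simp
  have e2 : Fin.append (Fin.append a b) b' ∘ Fin.natAdd (X.arity + Y.arity) = b' := by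
    funext i; simp
  have e3 : Fin.append a b ∘ Fin.castAdd Y.arity = a := by funext i; simp
  have e4 : Fin.append a b ∘ Fin.natAdd X.arity = b := by funext i; simp
  have := Der.subst hF.single (Fin.append (Fin.append a b) b') (Γ := Γ) (by
    rw [ren_and, ren_app, ren_app, ← Function.comp_assoc, ← Function.comp_assoc, e1, e2, e3, e4]
    exact h.andI h')
  rwa [ren_tupEq, ← Function.comp_assoc, e1, e2, e4] at this

theorem IsArrow.elim {F} (hF : IsArrow X Y F) {ψ : Fml n} {a : Fin X.arity → Fin n}
    (h : Der ZF Γ (ren a X.fml))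
    (h' : ∀ Δ, (∀ χ, Der ZF Γ χ → Der ZF Δ (ren (Fin.castAdd Y.arity) χ)) →
      Der ZF Δ (app F (Fin.castAdd Y.arity ∘ a) (Fin.natAdd n)) →
      Der ZF Δ (ren (Fin.castAdd Y.arity) ψ)) : Der ZF Γ ψ := by
  have := Der.subst hF.total a h
  rw [ren_exs] at this
  exact this.exsE (h' _ (fun χ hχ => (hχ.ren _).weaken (Set.subset_insert _ _))
    (.hyp (Set.mem_insert _ _)))

theorem compI {p q r : ℕ} {F : Fml (p + q)} {G : Fml (q + r)} {a : Fin p → Fin n}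
    {c : Fin r → Fin n} (b : Fin q → Fin n) (h : Der ZF Γ (app F a b)) (h' : Der ZF Γ (app G b c)) :
    Der ZF Γ (app (compFml F G) a c) := by
  rw [app, compFml, ren_exs]
  refine .exsI b ?_
  rw [app, ren_ren, ren_and, ren_app, ren_app]
  convert h.andI h' using 3 <;> funext i <;> simp [liftN]

theorem compE {p q r : ℕ} {F : Fml (p + q)} {G : Fml (q + r)} {a : Fin p → Fin n}
    {c : Fin r → Fin n} {ψ : Fml n} (h : Der ZF Γ (app (compFml F G) a c))
    (h' : ∀ Δ, (∀ χ, Der ZF Γ χ → Der ZF Δ (ren (Fin.castAdd q) χ)) →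
      Der ZF Δ (app F (Fin.castAdd q ∘ a) (Fin.natAdd n)) →
      Der ZF Δ (app G (Fin.natAdd n) (Fin.castAdd q ∘ c)) →
      Der ZF Δ (ren (Fin.castAdd q) ψ)) : Der ZF Γ ψ := by
  have e1 : liftN q (Fin.append a c) ∘ Fin.castAdd q ∘ Fin.castAdd r = Fin.castAdd q ∘ a := by
    funext i; simp [liftN]
  have e2 : liftN q (Fin.append a c) ∘ Fin.castAdd q ∘ Fin.natAdd p = Fin.castAdd q ∘ c := by
    funext i; simp [liftN]
  have e3 : liftN q (Fin.append a c) ∘ Fin.natAdd (p + r) = Fin.natAdd n := by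
    funext i; simp [liftN]
  rw [app, compFml, ren_exs, ren_and, ren_app, ren_app, e1, e2, e3] at h
  have k := Der.hyp (T := ZF) (Set.mem_insert
    (app F (Fin.castAdd q ∘ a) (Fin.natAdd n) ⊓ app G (Fin.natAdd n) (Fin.castAdd q ∘ c))
    (ren (Fin.castAdd q) '' Γ))
  exact h.exsE (h' _ (fun χ hχ => (hχ.ren _).weaken (Set.subset_insert _ _)) k.andL k.andR)

theorem selfHyp {p q : ℕ} (F : Fml (p + q)) :
    Der ZF {F} (app F (Fin.castAdd q) (Fin.natAdd p)) := by
  rw [app_self]; exact .hyp rfl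

/-- To prove that arrow formulas are equivalent it suffices to prove one implication. -/
theorem IsArrow.iff_of_le {F G : Fml (X.arity + Y.arity)} (hF : IsArrow X Y F)
    (hG : IsArrow X Y G) (h : Der ZF {F} G) : Der ZF ∅ (F ⇔ G) := by
  refine .iffI (h.weaken (by simp)) ?_
  have g := (selfHyp G).weaken (Set.singleton_subset_iff.2 (Set.mem_insert G ∅))
  refine hF.elim (hG.src g) fun Δ wk f => ?_
  have g' := wk _ g
  rw [ren_app] at g'
  have e := hG.uniq (Der.subst h _ f) g'
  have := Der.appCongr F (.tupRefl _) e f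
  rwa [← ren_app, app_self] at this

theorem isArrow_id (X : ZFCat) : IsArrow X X (idFml X) where
  typed := by
    have h : Der ZF {idFml X} (idFml X) := .hyp rfl
    refine h.andR.andI ?_
    exact Der.renCongr X.fml (fun i => h.andL.conjE i) h.andR
  single := by
    refine Der.tupSymm ?_
    have h := Der.hyp (T := ZF) (Set.mem_singleton
      (app (idFml X) (Fin.castAdd X.arity ∘ Fin.castAdd X.arity)
        (Fin.castAdd X.arity ∘ Fin.natAdd X.arity) ⊓
      app (idFml X) (Fin.castAdd X.arity ∘ Fin.castAdd X.arity)
        (Fin.natAdd (X.arity + X.arity))))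
    have h1 := h.andL.andL
    have h2 := h.andR.andL
    refine .conjI fun i => ?_
    change Der ZF _ (ren _ (tupEq _ _)) at h1
    change Der ZF _ (ren _ (tupEq _ _)) at h2
    rw [ren_tupEq] at h1 h2
    have e1 := h1.conjE i
    have e2 := h2.conjE i
    simp only [Function.comp, Fin.append_left, Fin.append_right] at e1 e2
    exact e2.eqSymm.eqTrans e1
  total := by
    refine .exsI id ?_
    rw [app, idFml, ren_and, ren_tupEq, ren_ren]
    have e1 : Fin.append (id : Fin X.arity → Fin X.arity) id ∘ Fin.castAdd X.arity = id := by
      funext i; simp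
    have e2 : Fin.append (id : Fin X.arity → Fin X.arity) id ∘ Fin.natAdd X.arity = id := by
      funext i; exact Fin.append_right _ _ i
    rw [e1, e2, ren_id]
    exact (Der.tupRefl _).andI (.hyp rfl)

theorem idFmlE {a b : Fin X.arity → Fin n} (h : Der ZF Γ (app (idFml X) a b)) :
    Der ZF Γ (tupEq a b) := by
  have h1 := h.andL
  change Der ZF _ (ren _ (tupEq _ _)) at h1
  rw [ren_tupEq] at h1
  convert h1 using 2 <;> funext i
  · exact (Fin.append_left _ _ i).symm
  · exact (Fin.append_right _ _ i).symm

theorem isArrow_comp {F G} (hF : IsArrow X Y F) (hG : IsArrow Y Z G) :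
    IsArrow X Z (compFml F G) where
  typed := by
    refine compE (selfHyp _) fun Δ wk f g => ?_
    rw [ren_and, ren_ren, ren_ren]
    exact (hF.src f).andI (hG.tgt g)
  single := by
    have h := Der.hyp (T := ZF) (Set.mem_singleton
      (app (compFml F G) (Fin.castAdd Z.arity ∘ Fin.castAdd Z.arity)
        (Fin.castAdd Z.arity ∘ Fin.natAdd X.arity) ⊓
      app (compFml F G) (Fin.castAdd Z.arity ∘ Fin.castAdd Z.arity)
        (Fin.natAdd (X.arity + Z.arity))))
    refine compE h.andL fun Δ wk f g => ?_
    have h2 := wk _ h.andR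
    rw [ren_app] at h2
    refine compE h2 fun Δ' wk' f' g' => ?_
    have f := wk' _ f
    have g := wk' _ g
    rw [ren_app] at f g
    rw [ren_tupEq, ren_tupEq]
    exact hG.uniq g (Der.appCongr G (hF.uniq f' f) (.tupRefl _) g')
  total := by
    have h : Der ZF {X.fml} (ren id X.fml) := by rw [ren_id]; exact .hyp rfl
    refine hF.elim h fun Δ wk f => hG.elim (hF.tgt f) fun Δ' wk' g => ?_
    have f := wk' _ f
    rw [ren_app] at f
    rw [ren_ren, ren_exs]
    refine .exsI (Fin.natAdd _) ?_
    rw [app, ren_ren]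
    have e : Fin.append id (Fin.natAdd (X.arity + Y.arity)) ∘
        liftN Z.arity (Fin.castAdd Z.arity ∘ (Fin.castAdd Y.arity : Fin X.arity → _)) =
        Fin.append (Fin.castAdd Z.arity ∘ Fin.castAdd Y.arity)
          (Fin.natAdd (X.arity + Y.arity)) := by
      rw [liftN, comp_append]
      congr 1 <;> funext i <;> simp
    rw [e]
    exact compI (Fin.castAdd Z.arity ∘ Fin.natAdd X.arity) f g

end

namespace ZFCat

/-- Two formulas that define arrows are identified if ZF proves them equivalent. -/
instance homSetoid (X Y : ZFCat) : Setoid {F : Fml (X.arity + Y.arity) // IsArrow X Y F} where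
  r F G := Der ZF ∅ (F.1 ⇔ G.1)
  iseqv :=
    { refl := fun _ => .iffI (.hyp (Set.mem_insert _ _)) (.hyp (Set.mem_insert _ _))
      symm := fun h => h.andR.andI h.andL
      trans := fun h h' =>
        .iffI (.iffL (h'.weaken (Set.empty_subset _))
            (.iffL (h.weaken (Set.empty_subset _)) (.hyp (Set.mem_insert _ _))))
          (.iffR (h.weaken (Set.empty_subset _))
            (.iffR (h'.weaken (Set.empty_subset _)) (.hyp (Set.mem_insert _ _)))) }

/-- The arrows of the syntactic category. -/
def Hom (X Y : ZFCat) : Type := Quotient (homSetoid X Y)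

/-- The arrow `[{x, y | F}]` that is defined by a formula. -/
def Hom.mk {X Y : ZFCat} {F : Fml (X.arity + Y.arity)} (hF : IsArrow X Y F) : Hom X Y :=
  Quotient.mk _ ⟨F, hF⟩

theorem Hom.mk_eq {X Y : ZFCat} {F G : Fml (X.arity + Y.arity)} (hF : IsArrow X Y F)
    (hG : IsArrow X Y G) (h : Der ZF {F} G) : Hom.mk hF = Hom.mk hG :=
  Quotient.sound (hF.iff_of_le hG h)

/-- Composition of arrows. -/
def Hom.comp {X Y Z : ZFCat} (f : Hom X Y) (g : Hom Y Z) : Hom X Z :=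
  Quotient.liftOn₂ f g (fun F G => Hom.mk (isArrow_comp F.2 G.2)) (by
    intro F G F' G' hF hG
    refine Hom.mk_eq _ _ ?_
    have hF : Der ZF {F.1} F'.1 := .iffL (Der.weaken hF (Set.empty_subset _)) (.hyp rfl)
    have hG : Der ZF {G.1} G'.1 := .iffL (Der.weaken hG (Set.empty_subset _)) (.hyp rfl)
    refine compE (selfHyp _) fun Δ wk f g => ?_
    rw [← app_self (compFml F'.1 G'.1), ren_app]
    exact compI _ (Der.subst hF _ f) (Der.subst hG _ g))

/-- The syntactic category of ZF. -/
instance : Category.{0} ZFCat where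
  Hom := Hom
  id X := Hom.mk (isArrow_id X)
  comp := Hom.comp
  id_comp {X Y} f := by
    refine Quotient.inductionOn f fun F => Hom.mk_eq (isArrow_comp (isArrow_id X) F.2) F.2 ?_
    refine compE (selfHyp _) fun Δ wk f g => ?_
    rw [← app_self F.1, ren_app]
    exact Der.appCongr F.1 (idFmlE f).tupSymm (.tupRefl _) g
  comp_id {X Y} f := by
    refine Quotient.inductionOn f fun F => Hom.mk_eq (isArrow_comp F.2 (isArrow_id Y)) F.2 ?_
    refine compE (selfHyp _) fun Δ wk f g => ?_
    rw [← app_self F.1, ren_app]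
    exact Der.appCongr F.1 (.tupRefl _) (idFmlE g) f
  assoc {X Y Z W} f g h := by
    refine Quotient.inductionOn₃ f g h fun F G H => Hom.mk_eq
      (isArrow_comp (isArrow_comp F.2 G.2) H.2) (isArrow_comp F.2 (isArrow_comp G.2 H.2)) ?_
    refine compE (selfHyp _) fun Δ wk fg h => compE fg fun Δ' wk' f g => ?_
    have h := wk' _ h
    rw [ren_app] at h
    rw [← app_self (compFml F.1 (compFml G.1 H.1)), ren_app, ren_app]
    exact compI _ f (compI _ g h)

end ZFCat

/-! ### Internal categories -/

/-- `(C₀, C₁, δ₀, δ₁, ID, comp)` is an internal category of `C`, where `C₂` with the projections `p₀`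
and `p₁` is the object `C₁ ×_{C₀} C₁` of composable pairs, the pullback of `δ₁` and `δ₀`. Here
`IsPullback.lift` is the arrow `⌈f, f'⌉` into a pullback, and `T` with the projections `q₀`, `q₁` is
the object of composable triples, the pullback of `δ₁ ∘ comp` and `δ₀`. -/
structure IsInternalCategory {C : Type*} [Category C] {C₀ C₁ C₂ : C} (δ₀ δ₁ : C₁ ⟶ C₀)
    (ID : C₀ ⟶ C₁) (p₀ p₁ : C₂ ⟶ C₁) (comp : C₂ ⟶ C₁) : Prop where
  isPullback : IsPullback p₀ p₁ δ₁ δ₀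
  id_cod : ID ≫ δ₁ = 𝟙 C₀
  id_dom : ID ≫ δ₀ = 𝟙 C₀
  comp_dom : comp ≫ δ₀ = p₀ ≫ δ₀
  comp_cod : comp ≫ δ₁ = p₁ ≫ δ₁
  id_comp : isPullback.lift (δ₀ ≫ ID) (𝟙 C₁) (by simp [id_cod]) ≫ comp = 𝟙 C₁
  comp_id : isPullback.lift (𝟙 C₁) (δ₁ ≫ ID) (by simp [id_dom]) ≫ comp = 𝟙 C₁
  hasTriples : HasPullback (comp ≫ δ₁) δ₀
  assoc : ∀ {T : C} (q₀ : T ⟶ C₂) (q₁ : T ⟶ C₁) (h : IsPullback q₀ q₁ (comp ≫ δ₁) δ₀),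
    isPullback.lift (q₀ ≫ comp) q₁ (by simpa using h.w) ≫ comp =
      isPullback.lift (q₀ ≫ p₀)
        (isPullback.lift (q₀ ≫ p₁) q₁ (by simpa [comp_cod] using h.w) ≫ comp)
        (by simp [comp_dom, isPullback.w]) ≫ comp

/-! ### The data of the category of sets -/

/-- The arrow `[{x, y | F}]` of the syntactic category. -/
def arrow {X Y : ZFCat} {F : Fml (X.arity + Y.arity)} (hF : IsArrow X Y F) : X ⟶ Y :=
  ZFCat.Hom.mk hF

/-- `v₀ = ⟨v₁, v₂⟩ ∧ Fun(v₁) ∧ ran(v₁) ⊆ v₂`. -/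
def isMap : Fml 3 := isPair ⊓ ren ![1] isFun ⊓ ren ![1, 2] ranSub

/-- `v₀ = ⟨v₁, ⟨v₂, v₃⟩⟩ ∧ Fun(v₁) ∧ Fun(v₂) ∧ ran(v₁) ⊆ dom(v₂) ∧ ran(v₂) ⊆ v₃`. -/
def isComposable : Fml 4 :=
  isTriple ⊓ ren ![1] isFun ⊓ ren ![2] isFun ⊓ ren ![1, 2] ranSubDom ⊓ ren ![2, 3] ranSub

/-- The object of objects `{x | x = x}`. -/
def SET₀ : ZFCat := ⟨1, eq 0 0⟩

/-- The object of arrows `{F | ∃ f ∃ z (F = ⟨f, z⟩ ∧ Fun(f) ∧ ran(f) ⊆ z)}`. -/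
def SET₁ : ZFCat := ⟨1, ∃' ∃' isMap⟩

/-- The object of composable arrows `{J | ∃ f ∃ f' ∃ z (J = ⟨f, ⟨f', z⟩⟩ ∧ Fun(f) ∧ Fun(f') ∧
ran(f) ⊆ dom(f') ∧ ran(f') ⊆ z)}`. -/
def SET₂ : ZFCat := ⟨1, ∃' ∃' ∃' isComposable⟩

/-- Domain: `{F, x | ∃ f ∃ z (F = ⟨f, z⟩ ∧ Fun(f) ∧ ran(f) ⊆ z ∧ dom(f) = x)}`. Here `F`, `x`, `f`,
`z` have the numbers 0, 1, 2, 3. -/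
def domFml : Fml 2 := ∃' ∃' (ren ![0, 2, 3] isMap ⊓ ren ![2, 1] isDom)

/-- Codomain: `{F, z | ∃ f (F = ⟨f, z⟩ ∧ Fun(f) ∧ ran(f) ⊆ z)}`. Here `F`, `z`, `f` have the
numbers 0, 1, 2. -/
def codFml : Fml 2 := ∃' (ren ![0, 2, 1] isMap)

/-- Identities: `{x, F | ∃ f (F = ⟨f, x⟩ ∧ ∀ t (t ∈ f ↔ ∃ s (s ∈ x ∧ t = ⟨s, s⟩)))}`. Here `x`, `F`,
`f`, `t`, `s` have the numbers 0, 1, 2, 3, 4. -/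
def identFml : Fml 2 :=
  ∃' (ren ![1, 2, 0] isPair ⊓ ∀' (mem 3 2 ⇔ ∃' (mem 4 0 ⊓ ren ![3, 4, 4] isPair)))

/-- First projection of composable arrows: `J = ⟨f, ⟨f', z⟩⟩` goes to `F = ⟨f, dom(f')⟩`. Here `J`,
`F`, `f`, `f'`, `z` have the numbers 0, …, 4, and `dom(f')` has the number 5. -/
def fstFml : Fml 2 :=
  ∃' ∃' ∃' (ren ![0, 2, 3, 4] isComposable ⊓ ∃' (ren ![3, 5] isDom ⊓ ren ![1, 2, 5] isPair))

/-- Second projection of composable arrows: `J = ⟨f, ⟨f', z⟩⟩` goes to `F = ⟨f', z⟩`. Here `J`, `F`,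
`f`, `f'`, `z` have the numbers 0, …, 4. -/
def sndFml : Fml 2 :=
  ∃' ∃' ∃' (ren ![0, 2, 3, 4] isComposable ⊓ ren ![1, 3, 4] isPair)

/-- Composition: `{J, G | ∃ f ∃ f' ∃ z ∃ f'' (J = ⟨f, ⟨f', z⟩⟩ ∧ Fun(f) ∧ Fun(f') ∧
ran(f) ⊆ dom(f') ∧ ran(f') ⊆ z ∧ G = ⟨f'', z⟩ ∧
∀ t (t ∈ f'' ↔ ∃ s ∃ s' ∃ s'' (⟨s, s'⟩ ∈ f ∧ ⟨s', s''⟩ ∈ f' ∧ t = ⟨s, s''⟩)))}`. Here `J`, `G`, `f`,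
`f'`, `z`, `f''`, `t`, `s`, `s'`, `s''` have the numbers 0, …, 9. -/
def boxFml : Fml 2 :=
  ∃' ∃' ∃' ∃' (ren ![0, 2, 3, 4] isComposable ⊓ ren ![1, 5, 4] isPair ⊓
    ∀' (mem 6 5 ⇔
      ∃' ∃' ∃' (ren ![7, 8, 2] pairMem ⊓ ren ![8, 9, 3] pairMem ⊓ ren ![6, 7, 9] isPair)))

end ZFSyn

/-! The claim is a family of derivability statements. By Gödel's completeness theorem
(`Der.complete`) each of them may be checked in an arbitrary model `M` of ZF, where formulas become
relations and the argument is ordinary set theory.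

Completeness is proved for formulas in context. Consistent finite-context sets of assumptions are
ordered by extension. Every formula is decided, with a witness when a universal formula is refuted,
on a cofinal set of conditions. There are countably many formulas, so some ideal meets all these
sets. The variables modulo the equations forced by the ideal form a model in which truth is the same
as being forced (`holds_iff_forces`).

An object then has a set of points `Pts M X` in each model, and an arrow induces a function `ev`
between points, compatibly with identities and composition. Arrows with the same functions in all
models are equal (`hom_ext_of_models`), and a definable functional relation gives an arrow
(`exists_hom_of_models`). Hence a square that is a pullback on points in every model is a pullback
(`isPullback_of_models`): the mediating relation is definable from the four given arrows. The same
method constructs all pullbacks (`hasPullback`).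

Inside `M`, extensionality, pairing, separation and replacement provide ordered pairs, domains,
identity functions and composites. The points of `SET₁` are the pairs of a function and a codomain
containing its range, those of `SET₂` are the composable pairs, and the six arrows act as expected.
The axioms of an internal category thereby reduce to the domain of a composite (`IsMap.dom_comp`),
the unit laws and associativity of composition of functions. -/

namespace ZFSyn

open FirstOrder.Language

/-! ### Semantics and soundness -/

section Semantics

variable {M : Type} [setLang.Structure M]

/-- Satisfaction of a formula in context by a list of elements of a structure. -/
def Holds {n : ℕ} (φ : Fml n) (x : Fin n → M) : Prop :=
  BoundedFormula.Realize φ (default : Empty → M) x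

/-- The membership relation of a structure. -/
def E (a b : M) : Prop := Structure.RelMap (L := setLang) MemRel.mem ![a, b]

/-- The language has no function symbols. With `exists_eq_mem`, this puts every atomic formula into
one of two standard forms for inductions on formulas. -/
theorem exists_eq_var {n : ℕ} (t : setLang.Term (Empty ⊕ Fin n)) :
    ∃ i, t = Term.var (Sum.inr i) := by
  cases t with
  | var a =>
    rcases a with e | i
    · exact e.elim
    · exact ⟨i, rfl⟩
  | func f _ => exact Empty.elim f

theorem exists_eq_mem {n l : ℕ} (R : setLang.Relations l)
    (ts : Fin l → setLang.Term (Empty ⊕ Fin n)) :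
    ∃ i j, (BoundedFormula.rel R ts : Fml n) = mem i j := by
  obtain ⟨rfl, hR⟩ : ∃ h : l = 2, h ▸ R = MemRel.mem := by
    change MemRel l at R; cases R; exact ⟨rfl, rfl⟩
  obtain rfl : R = MemRel.mem := hR
  obtain ⟨i, hi⟩ := exists_eq_var (ts 0)
  obtain ⟨j, hj⟩ := exists_eq_var (ts 1)
  refine ⟨i, j, ?_⟩
  rw [mem]
  congr 1
  funext k
  fin_cases k
  · exact hi
  · exact hj

variable {n : ℕ}

@[simp] theorem holds_top (x : Fin n → M) : Holds ⊤ x ↔ True := BoundedFormula.realize_top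

@[simp] theorem holds_eq (i j : Fin n) (x : Fin n → M) : Holds (eq i j) x ↔ x i = x j := Iff.rfl

@[simp] theorem holds_mem (i j : Fin n) (x : Fin n → M) : Holds (mem i j) x ↔ E (x i) (x j) := by
  refine iff_of_eq (congrArg (Structure.RelMap (L := setLang) (M := M) MemRel.mem) ?_)
  funext k
  fin_cases k <;> rfl

@[simp] theorem holds_imp (φ ψ : Fml n) (x : Fin n → M) :
    Holds (φ ⟹ ψ) x ↔ (Holds φ x → Holds ψ x) := Iff.rfl

@[simp] theorem holds_and (φ ψ : Fml n) (x : Fin n → M) :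
    Holds (φ ⊓ ψ) x ↔ Holds φ x ∧ Holds ψ x := BoundedFormula.realize_inf

@[simp] theorem holds_or (φ ψ : Fml n) (x : Fin n → M) :
    Holds (φ ⊔ ψ) x ↔ Holds φ x ∨ Holds ψ x := BoundedFormula.realize_sup

@[simp] theorem holds_iff (φ ψ : Fml n) (x : Fin n → M) :
    Holds (φ ⇔ ψ) x ↔ (Holds φ x ↔ Holds ψ x) := BoundedFormula.realize_iff

@[simp] theorem holds_all (φ : Fml (n + 1)) (x : Fin n → M) :
    Holds (∀' φ) x ↔ ∀ a : M, Holds φ (Fin.snoc x a) := Iff.rfl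

@[simp] theorem holds_ex (φ : Fml (n + 1)) (x : Fin n → M) :
    Holds (∃' φ) x ↔ ∃ a : M, Holds φ (Fin.snoc x a) := BoundedFormula.realize_ex

omit [setLang.Structure M] in
theorem snoc_comp_lift {m : ℕ} (ρ : Fin n → Fin m) (x : Fin m → M) (a : M) :
    (Fin.snoc x a : Fin (m + 1) → M) ∘ lift ρ = Fin.snoc (x ∘ ρ) a := by
  funext i
  refine Fin.lastCases ?_ (fun i => ?_) i <;> simp [lift]

-- The semantic substitution lemma: renaming variables is precomposition of assignments. Below a
-- quantifier, `lift` matches the extension of the assignment by the value of the bound variable.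
@[simp] theorem holds_ren (φ : Fml n) : ∀ {m : ℕ} (ρ : Fin n → Fin m) (x : Fin m → M),
    Holds (ren ρ φ) x ↔ Holds φ (x ∘ ρ) := by
  induction φ with
  | falsum => intros; rfl
  | equal t s =>
    intro m ρ x
    obtain ⟨i, rfl⟩ := exists_eq_var t
    obtain ⟨j, rfl⟩ := exists_eq_var s
    rfl
  | rel R ts =>
    intro m ρ x
    obtain ⟨i, j, h⟩ := exists_eq_mem R ts
    rw [h, ren_mem, holds_mem, holds_mem]
    rfl
  | imp _ _ h1 h2 => intro m ρ x; exact imp_congr (h1 ρ x) (h2 ρ x)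
  | all _ h =>
    intro m ρ x
    refine forall_congr' fun a => ?_
    rw [← snoc_comp_lift]
    exact h _ _

theorem holds_exs (x : Fin n → M) : ∀ (k : ℕ) (φ : Fml (n + k)),
    Holds (exs k φ) x ↔ ∃ y : Fin k → M, Holds φ (Fin.append x y)
  | 0, φ => by
    have h : ∀ y : Fin 0 → M, Fin.append x y = x := fun y => by
      funext i; exact Fin.append_left (m := n) (n := 0) x y i
    simp only [exs, h, exists_const]
  | k + 1, φ => by
    simp only [exs]
    rw [holds_exs x k]
    simp only [holds_ex, ← Fin.append_snoc]
    constructor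
    · rintro ⟨y, a, h⟩
      exact ⟨_, h⟩
    · rintro ⟨y, h⟩
      refine ⟨Fin.init y, y (Fin.last k), ?_⟩
      rwa [Fin.snoc_init_self]

theorem holds_conj (x : Fin n → M) : ∀ (k : ℕ) (f : Fin k → Fml n),
    Holds (conj k f) x ↔ ∀ i, Holds (f i) x
  | 0, _ => by simp [conj]
  | k + 1, f => by
    rw [conj, holds_and, holds_conj x k, Fin.forall_fin_succ']

@[simp] theorem holds_tupEq {m : ℕ} (a b : Fin m → Fin n) (x : Fin n → M) :
    Holds (tupEq a b) x ↔ x ∘ a = x ∘ b := by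
  simp only [tupEq, holds_conj, holds_eq, funext_iff, Function.comp]

@[simp] theorem holds_app {k m : ℕ} (F : Fml (k + m)) (a : Fin k → Fin n) (b : Fin m → Fin n)
    (x : Fin n → M) : Holds (app F a b) x ↔ Holds F (Fin.append (x ∘ a) (x ∘ b)) := by
  rw [app, holds_ren]
  refine iff_of_eq (congrArg _ ?_)
  funext i
  refine Fin.addCases (fun i => ?_) (fun i => ?_) i <;> simp

omit [setLang.Structure M] in
theorem snoc_comp_castSucc (x : Fin n → M) (a : M) :
    (Fin.snoc x a : Fin (n + 1) → M) ∘ Fin.castSucc = x := by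
  funext i; simp

omit [setLang.Structure M] in
theorem comp_snoc_id_eq (x : Fin n → M) (i : Fin n) :
    x ∘ Fin.snoc (α := fun _ => Fin n) id i = Fin.snoc x (x i) := by
  funext j
  refine Fin.lastCases ?_ (fun j => ?_) j <;> simp

/-- Soundness of natural deduction. -/
theorem Der.sound {T : setLang.Theory} [Nonempty M] [M ⊨ T] {Γ : Set (Fml n)} {φ : Fml n}
    (h : Der T Γ φ) (x : Fin n → M) (hx : ∀ χ ∈ Γ, Holds χ x) : Holds φ x := by
  induction h with
  | @axm n Γ φ h =>
    rw [holds_ren]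
    have := Theory.realize_sentence_of_mem (M := M) T h
    rw [Sentence.Realize, Formula.Realize] at this
    rw [Holds, Subsingleton.elim (x ∘ _) default]
    exact this
  | hyp h => exact hx _ h
  | impI _ ih =>
    intro hφ
    exact ih x (Set.forall_mem_insert.2 ⟨hφ, hx⟩)
  | impE _ _ ih1 ih2 => exact ih1 x hx (ih2 x hx)
  | raa _ ih =>
    by_contra hφ
    exact ih x (Set.forall_mem_insert.2 ⟨hφ, hx⟩)
  | allI _ ih =>
    intro a
    refine ih _ (Set.forall_mem_image.2 fun χ hχ => ?_)
    rw [holds_ren, snoc_comp_castSucc]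
    exact hx χ hχ
  | allE i _ ih =>
    rw [holds_ren, comp_snoc_id_eq]
    exact ih x hx _
  | eqRefl i => rfl
  | eqSubst φ _ _ ih1 ih2 =>
    have h1 := ih1 x hx
    have h2 := ih2 x hx
    rw [holds_ren, comp_snoc_id_eq] at h2 ⊢
    rw [holds_eq] at h1
    rwa [← h1]
  -- This rule is sound because the model is nonempty.
  | inhab => rw [holds_ex]; exact ⟨Classical.arbitrary M, rfl⟩

end Semantics

/-! ### Completeness -/

/-- Countability allows one ideal of conditions to meet the requirements of all formulas at once. -/
instance : Countable (Σ n, Fml n) := by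
  have (l : ℕ) : Countable (MemRel l) :=
    have : Subsingleton (MemRel l) := ⟨fun a b => by cases a; cases b; rfl⟩
    inferInstance
  have : Countable setLang.Symbols :=
    inferInstanceAs (Countable ((Σ _ : ℕ, Empty) ⊕ Σ l, MemRel l))
  refine Cardinal.mk_le_aleph0_iff.1 (BoundedFormula.card_le.trans ?_)
  have h : setLang.card ≤ Cardinal.aleph0 := Cardinal.mk_le_aleph0_iff.2 this
  simpa using h

/-- A consistent set of assumptions in some context. -/
structure Condition (T : setLang.Theory) where
  /-- The length of the context. -/
  len : ℕ
  /-- The assumptions. -/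
  asm : Set (Fml len)
  consistent : ¬ Der T asm ⊥

namespace Condition

variable {T : setLang.Theory}

/-- Larger conditions carry more information: they may add variables, the old variables keep their
numbers, and all consequences are preserved. Comparing consequences instead of assumption sets makes
the order insensitive to the presentation. -/
instance : Preorder (Condition T) where
  le s t := ∃ h : s.len ≤ t.len, ∀ φ, Der T s.asm φ → Der T t.asm (ren (Fin.castLE h) φ)
  le_refl s := ⟨le_rfl, fun φ h => (ren_id φ).symm ▸ h⟩
  le_trans s t u := fun ⟨h, k⟩ ⟨h', k'⟩ => ⟨h.trans h', fun φ hφ => by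
    have := k' _ (k φ hφ)
    rwa [ren_ren] at this⟩

theorem le_of_subset {s : Condition T} {Δ : Set (Fml s.len)} (hΔ : ¬ Der T Δ ⊥)
    (h : s.asm ⊆ Δ) : s ≤ ⟨s.len, Δ, hΔ⟩ :=
  ⟨le_rfl, fun φ hφ => (ren_id φ).symm ▸ hφ.weaken h⟩

theorem le_of_castSucc {s : Condition T} {Δ : Set (Fml (s.len + 1))} (hΔ : ¬ Der T Δ ⊥)
    (h : ren Fin.castSucc '' s.asm ⊆ Δ) : s ≤ ⟨s.len + 1, Δ, hΔ⟩ :=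
  ⟨Nat.le_succ _, fun _ hφ => (hφ.ren Fin.castSucc).weaken h⟩

theorem exists_ge_len (s : Condition T) (m : ℕ) : ∃ t, s ≤ t ∧ m ≤ t.len := by
  induction m with
  | zero => exact ⟨s, le_rfl, Nat.zero_le _⟩
  | succ m ih =>
    obtain ⟨t, hst, hm⟩ := ih
    -- A fresh variable does no harm: a contradiction derived with it would follow without it, by
    -- eliminating `∃ x, x = x`, which is the rule `inhab`.
    have hc : ¬ Der T (ren Fin.castSucc '' t.asm) ⊥ := fun h =>
      t.consistent (Der.exE Der.inhab (h.weaken (Set.subset_insert _ _)))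
    exact ⟨_, hst.trans (le_of_castSucc hc subset_rfl), Nat.succ_le_succ hm⟩

/-- The condition proves the formula, or it refutes it and has a witness in case it refutes a
universal formula. -/
def Decides (t : Condition T) {m : ℕ} (φ : Fml m) : Prop :=
  ∃ h : m ≤ t.len, Der T t.asm (ren (Fin.castLE h) φ) ∨
    (Der T t.asm (∼(ren (Fin.castLE h) φ)) ∧ ∀ ψ, φ = ∀' ψ → ∃ i : Fin t.len,
      Der T t.asm (∼(ren (Fin.snoc (α := fun _ => Fin t.len) (Fin.castLE h) i) ψ)))

/-- Density of the deciding conditions. If `φ` is not derivable, then its negation can be added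
consistently. If moreover `φ` is universal, a fresh variable can be added as a counterexample, since
refuting that counterexample would derive `φ` by generalization. -/
theorem exists_decides (s : Condition T) {m : ℕ} (φ : Fml m) : ∃ t, t.Decides φ ∧ s ≤ t := by
  obtain ⟨t, hst, hm⟩ := s.exists_ge_len m
  by_cases hφ : Der T t.asm (ren (Fin.castLE hm) φ)
  · exact ⟨t, ⟨hm, .inl hφ⟩, hst⟩
  have hu : ¬ Der T (insert (∼(ren (Fin.castLE hm) φ)) t.asm) ⊥ := fun h => hφ (.raa h)
  have htu := hst.trans (le_of_subset hu (Set.subset_insert _ _))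
  by_cases hall : ∃ ψ, φ = ∀' ψ
  · obtain ⟨ψ, rfl⟩ := hall
    have hw : ¬ Der T (insert (∼(ren (lift (Fin.castLE hm)) ψ))
        (ren Fin.castSucc '' insert (∼(ren (Fin.castLE hm) (∀' ψ))) t.asm)) ⊥ := fun h =>
      hu (.impE (.hyp (Set.mem_insert _ _)) (.allI (.raa h)))
    refine ⟨⟨t.len + 1, _, hw⟩, ⟨hm.trans (Nat.le_succ _), .inr ⟨?_, fun ψ' e => ⟨Fin.last _, ?_⟩⟩⟩,
      htu.trans (le_of_castSucc (s := ⟨_, _, hu⟩) hw (Set.subset_insert _ _))⟩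
    · refine .hyp (Set.mem_insert_of_mem _ ⟨_, Set.mem_insert _ _, ?_⟩)
      rw [ren_not, ren_ren]
      rfl
    · obtain rfl : ψ = ψ' := by injection e
      exact .hyp (Set.mem_insert _ _)
  · exact ⟨⟨_, _, hu⟩, ⟨hm, .inr ⟨.hyp (Set.mem_insert _ _), fun ψ e => (hall ⟨ψ, e⟩).elim⟩⟩, htu⟩

end Condition

/-! ### Generic ideals, term models and the truth lemma -/

section Henkin

open Order

variable {T : setLang.Theory}

noncomputable instance : Encodable (Σ n, Fml n) := Encodable.ofCountable _

/-- An ideal of conditions that decides all formulas. -/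
structure GenericIdeal (T : setLang.Theory) where
  /-- The ideal. -/
  ideal : Ideal (Condition T)
  decides : ∀ {m : ℕ} (φ : Fml m), ∃ t ∈ ideal, t.Decides φ

/-- The Rasiowa–Sikorski lemma: the requirements are cofinal by `exists_decides` and are indexed by
the encodable type of formulas. -/
theorem Condition.exists_genericIdeal (s : Condition T) :
    ∃ G : GenericIdeal T, s ∈ G.ideal := by
  let D : (Σ n, Fml n) → Cofinal (Condition T) := fun φ =>
    ⟨{t | t.Decides φ.2}, fun s => s.exists_decides φ.2⟩
  refine ⟨⟨idealOfCofinals s D, fun {m} φ => ?_⟩, mem_idealOfCofinals s D⟩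
  obtain ⟨t, h, h'⟩ := cofinal_meets_idealOfCofinals s D ⟨m, φ⟩
  exact ⟨t, h', h⟩

namespace Condition

/-- The condition proves the formula if the variables are replaced with those numbered by `v`. -/
def Forces (s : Condition T) {n : ℕ} (φ : Fml n) (v : Fin n → ℕ) : Prop :=
  ∃ h : ∀ i, v i < s.len, Der T s.asm (ren (fun i => ⟨v i, h i⟩) φ)

theorem Forces.mono {s t : Condition T} (hst : s ≤ t) {n : ℕ} {φ : Fml n} {v : Fin n → ℕ}
    (h : s.Forces φ v) : t.Forces φ v := by
  obtain ⟨hv, h⟩ := h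
  obtain ⟨hl, ht⟩ := hst
  have := ht _ h
  rw [ren_ren] at this
  exact ⟨fun i => (hv i).trans_le hl, this⟩

end Condition

namespace GenericIdeal

variable (G : GenericIdeal T) {n : ℕ}

/-- Some condition in the ideal forces the formula. -/
def Forces (φ : Fml n) (v : Fin n → ℕ) : Prop := ∃ s ∈ G.ideal, s.Forces φ v

variable {G}

/-- A condition can decide a formula in context `m` only if it has at least `m` variables, so the
choice of formula is immaterial. -/
theorem exists_len (m : ℕ) : ∃ s ∈ G.ideal, m ≤ s.len := by
  obtain ⟨t, ht, h, -⟩ := G.decides (⊥ : Fml m)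
  exact ⟨t, ht, h⟩

theorem exists_bound (v : Fin n → ℕ) : ∃ s ∈ G.ideal, ∀ i, v i < s.len := by
  obtain ⟨s, hs, h⟩ := G.exists_len (Finset.univ.sup v + 1)
  exact ⟨s, hs, fun i => (Nat.lt_succ_of_le (Finset.le_sup (Finset.mem_univ i))).trans_le h⟩

theorem exists_ge {s t : Condition T} (hs : s ∈ G.ideal) (ht : t ∈ G.ideal) :
    ∃ u ∈ G.ideal, s ≤ u ∧ t ≤ u := G.ideal.directed s hs t ht

theorem forces_imp {φ ψ : Fml n} {v : Fin n → ℕ} (h : G.Forces (φ ⟹ ψ) v)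
    (h' : G.Forces φ v) : G.Forces ψ v := by
  obtain ⟨s, hs, h⟩ := h
  obtain ⟨t, ht, h'⟩ := h'
  obtain ⟨u, hu, hsu, htu⟩ := exists_ge hs ht
  obtain ⟨_, h⟩ := h.mono hsu
  obtain ⟨_, h'⟩ := h'.mono htu
  exact ⟨u, hu, _, .impE h h'⟩

theorem forces_bot {v : Fin n → ℕ} : ¬ G.Forces ⊥ v := fun ⟨s, _, _, h⟩ => s.consistent h

/-- Closure of the forced formulas under rules of inference. -/
theorem forces_of_der {φ ψ : Fml n} {v : Fin n → ℕ} (h : Der T {φ} ψ) (h' : G.Forces φ v) :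
    G.Forces ψ v := by
  obtain ⟨s, hs, _, h'⟩ := h'
  exact ⟨s, hs, _, Der.subst h _ h'⟩

/-- Every formula is forced or refuted, with a witness in the case of universal formulas. -/
theorem forces_or (φ : Fml n) (v : Fin n → ℕ) :
    G.Forces φ v ∨ (G.Forces (∼φ) v ∧
      ∀ ψ, φ = ∀' ψ → ∃ k, G.Forces (∼ψ) (Fin.snoc (α := fun _ => ℕ) v k)) := by
  obtain ⟨s, hs, hv⟩ := G.exists_bound v
  -- `Decides` reads the variables of a formula under their own numbers. Renaming `φ` along `v`
  -- first reduces the case of an arbitrary `v` to this one.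
  set ρ : Fin n → Fin s.len := fun i => ⟨v i, hv i⟩ with hρ
  obtain ⟨t, ht, h, H⟩ := G.decides (ren ρ φ)
  rw [ren_ren] at H
  refine H.imp (fun h' => ⟨t, ht, fun i => (hv i).trans_le h, h'⟩) fun ⟨h1, h2⟩ =>
    ⟨⟨t, ht, fun i => (hv i).trans_le h, h1⟩, ?_⟩
  rintro ψ rfl
  obtain ⟨i, hi⟩ := h2 _ rfl
  refine ⟨i, t, ht, fun j => ?_, ?_⟩
  · refine Fin.lastCases ?_ (fun j => ?_) j
    · simp
    · simpa using (hv j).trans_le h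
  · rw [ren_ren] at hi
    rw [ren_not]
    convert hi using 3
    funext j
    refine Fin.lastCases ?_ (fun j => ?_) j
    · simp [lift]
    · simp only [lift, Function.comp, Fin.snoc_castSucc]; rfl

theorem forces_eq_iff {i j : ℕ} : G.Forces (eq 0 1) ![i, j] ↔
    ∃ s ∈ G.ideal, ∃ (hi : i < s.len) (hj : j < s.len), Der T s.asm (eq ⟨i, hi⟩ ⟨j, hj⟩) :=
  ⟨fun ⟨s, hs, h, h'⟩ => ⟨s, hs, h 0, h 1, h'⟩,
    fun ⟨s, hs, hi, hj, h⟩ => ⟨s, hs, Fin.forall_fin_two.2 ⟨hi, hj⟩, h⟩⟩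

variable (G) in
/-- Equality of variables according to the ideal. -/
def setoid : Setoid ℕ where
  r i j := G.Forces (eq 0 1) ![i, j]
  iseqv :=
    { refl := fun i => by
        obtain ⟨s, hs, h⟩ := G.exists_len (i + 1)
        exact forces_eq_iff.2 ⟨s, hs, h, h, .eqRefl _⟩
      symm := fun h => by
        obtain ⟨s, hs, hi, hj, h⟩ := forces_eq_iff.1 h
        exact forces_eq_iff.2 ⟨s, hs, hj, hi, h.eqSymm⟩
      trans := fun {i j k} h h' => by
        obtain ⟨s, hs, h⟩ := h
        obtain ⟨t, ht, h'⟩ := h'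
        obtain ⟨u, hu, hsu, htu⟩ := exists_ge hs ht
        obtain ⟨h1, h⟩ := h.mono hsu
        obtain ⟨h2, h'⟩ := h'.mono htu
        exact forces_eq_iff.2 ⟨u, hu, h1 0, h2 1, Der.eqTrans h h'⟩ }

variable (G) in
/-- The term model given by the ideal. -/
def Model : Type := Quotient G.setoid

variable (G) in
/-- The value of a variable in the term model. -/
def val (i : ℕ) : G.Model := Quotient.mk G.setoid i

theorem val_eq_iff {i j : ℕ} : G.val i = G.val j ↔ G.Forces (eq 0 1) ![i, j] := Quotient.eq

theorem val_surjective : Function.Surjective G.val := Quotient.mk_surjective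

instance : Nonempty G.Model := ⟨G.val 0⟩

/-- Membership holds if it is forced for some choice of representatives. The interpretation has to
be given for every arity `l`; comparing the numbers of indices avoids a transport along `l = 2`, the
only arity that has a relation symbol. -/
instance : setLang.Structure G.Model where
  funMap f := Empty.elim f
  RelMap {l} _ xs := ∃ v : Fin 2 → ℕ, (∀ (i : Fin l) (k : Fin 2), i.1 = k.1 → xs i = G.val (v k)) ∧
    G.Forces (mem 0 1) v

/-- Independence of the representatives: the two equations and the membership are all available at
one condition of the directed ideal, where equals may be substituted. -/
theorem e_val_iff {i j : ℕ} : E (G.val i) (G.val j) ↔ G.Forces (mem 0 1) ![i, j] := by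
  refine ⟨fun ⟨v, hv, h⟩ => ?_, fun h => ⟨![i, j], fun k k' e => ?_, h⟩⟩
  · have h0 := val_eq_iff.1 (hv 0 0 rfl).symm
    have h1 := val_eq_iff.1 (hv 1 1 rfl).symm
    obtain ⟨s, hs, h0⟩ := h0
    obtain ⟨t, ht, h1⟩ := h1
    obtain ⟨u, hu, h⟩ := h
    obtain ⟨w, hw, hsw, htw⟩ := exists_ge hs ht
    obtain ⟨w', hw', hww, huw⟩ := exists_ge hw hu
    obtain ⟨k0, h0⟩ := h0.mono (hsw.trans hww)
    obtain ⟨k1, h1⟩ := h1.mono (htw.trans hww)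
    obtain ⟨k2, h⟩ := h.mono huw
    refine ⟨w', hw', Fin.forall_fin_two.2 ⟨k0 1, k1 1⟩, Der.renCongr _ ?_ h⟩
    exact Fin.forall_fin_two.2 ⟨h0, h1⟩
  · obtain rfl : k = k' := Fin.ext e
    fin_cases k <;> rfl

/-- The truth lemma. -/
theorem holds_iff_forces (φ : Fml n) : ∀ v : Fin n → ℕ,
    Holds φ (G.val ∘ v) ↔ G.Forces φ v := by
  induction φ with
  | falsum => exact fun v => (iff_of_false id forces_bot)
  | equal t s =>
    intro v
    obtain ⟨i, rfl⟩ := exists_eq_var t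
    obtain ⟨j, rfl⟩ := exists_eq_var s
    refine Iff.trans (val_eq_iff (i := v i) (j := v j)) (forces_eq_iff.trans ?_)
    constructor
    · rintro ⟨s, hs, hi, hj, h⟩
      -- `Forces` asks for a condition that contains all variables in the range of `v`, not only the
      -- two that occur in the equation.
      obtain ⟨t, ht, hv⟩ := G.exists_bound v
      obtain ⟨u, hu, ⟨hsu, h'⟩, ⟨htu, -⟩⟩ := exists_ge hs ht
      exact ⟨u, hu, fun i => (hv i).trans_le htu, h' _ h⟩
    · rintro ⟨s, hs, hv, h⟩
      exact ⟨s, hs, hv i, hv j, h⟩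
  | rel R ts =>
    intro v
    obtain ⟨i, j, h⟩ := exists_eq_mem R ts
    rw [h, holds_mem]
    refine Iff.trans (e_val_iff (i := v i) (j := v j)) ?_
    have key : ∀ (s : Condition T) (hv : ∀ i, v i < s.len) (hv' : ∀ k, ![v i, v j] k < s.len),
        ren (fun k => ⟨![v i, v j] k, hv' k⟩) (mem 0 1) =
          ren (fun i => ⟨v i, hv i⟩) (mem i j) := fun s hv hv' => by
      rw [ren_mem, ren_mem]; rfl
    constructor
    · rintro ⟨s, hs, h⟩
      obtain ⟨t, ht, hv⟩ := G.exists_bound v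
      obtain ⟨u, hu, hsu, ⟨htu, -⟩⟩ := exists_ge hs ht
      obtain ⟨h1, h2⟩ := h.mono hsu
      exact ⟨u, hu, fun i => (hv i).trans_le htu, key u _ h1 ▸ h2⟩
    · rintro ⟨s, hs, hv, h⟩
      exact ⟨s, hs, Fin.forall_fin_two.2 ⟨hv i, hv j⟩, (key s hv _).symm ▸ h⟩
  | imp φ ψ h1 h2 =>
    intro v
    refine (imp_congr (h1 v) (h2 v)).trans ⟨fun h => ?_, forces_imp⟩
    -- The ideal is complete: if `φ` is not forced, its negation is, and this yields the
    -- implication.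
    rcases forces_or φ v with hφ | ⟨hφ, -⟩
    · exact forces_of_der (.impI (.hyp (Set.mem_insert_of_mem _ rfl))) (h hφ)
    · exact forces_of_der (φ := ∼φ) (.impI (Der.exfalso (.impE (φ := φ)
        (.hyp (Set.mem_insert_of_mem _ rfl)) (.hyp (Set.mem_insert _ _))))) hφ
  | all φ ih =>
    intro v
    have key (k : ℕ) : Holds φ (Fin.snoc (G.val ∘ v) (G.val k)) ↔
        G.Forces φ (Fin.snoc (α := fun _ => ℕ) v k) := by
      rw [← ih]
      refine iff_of_eq (congrArg _ ?_)
      funext i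
      refine Fin.lastCases ?_ (fun i => ?_) i <;> simp
    refine val_surjective.forall.trans ((forall_congr' key).trans ⟨fun h => ?_, fun h k => ?_⟩)
    -- If the universal formula were refuted, a witness `k` would refute an instance, against `h k`.
    · refine (forces_or (∀' φ) v).resolve_right fun ⟨_, h'⟩ => ?_
      obtain ⟨k, hk⟩ := h' φ rfl
      exact forces_bot (forces_imp hk (h k))
    · obtain ⟨s, hs, h⟩ := h
      -- The universal formula may be instantiated at variable `k` only in a condition whose context
      -- contains it.
      obtain ⟨t, ht, hk⟩ := G.exists_len (k + 1)
      obtain ⟨u, hu, hsu, ⟨htu, -⟩⟩ := exists_ge hs ht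
      obtain ⟨hv, h⟩ := h.mono hsu
      refine ⟨u, hu, ?_, ?_⟩
      · intro i
        refine Fin.lastCases ?_ (fun i => ?_) i
        · simpa using Nat.lt_of_succ_le (hk.trans htu)
        · simpa using hv i
      · have := Der.allE ⟨k, Nat.lt_of_succ_le (hk.trans htu)⟩ h
        rw [ren_ren] at this
        convert this using 2
        funext i
        refine Fin.lastCases ?_ (fun i => ?_) i
        · simp [lift]
        · simp only [lift, Function.comp, Fin.snoc_castSucc]; rfl

instance : G.Model ⊨ T where
  realize_of_mem φ hφ := by
    have : Holds (φ : Fml 0) (G.val ∘ Fin.elim0) := by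
      refine (holds_iff_forces _ _).2 ?_
      obtain ⟨s, hs, -⟩ := G.exists_len 0
      refine ⟨s, hs, fun i => i.elim0, ?_⟩
      have := Der.axm (T := T) (Γ := s.asm) hφ
      convert this using 2
    rw [Sentence.Realize, Formula.Realize]
    rwa [Holds, Subsingleton.elim (_ ∘ _) default] at this

end GenericIdeal

/-- Gödel's completeness theorem. -/
theorem Der.complete {n : ℕ} {Γ : Set (Fml n)} {φ : Fml n}
    (h : ∀ (M : Type) [setLang.Structure M] [Nonempty M] [M ⊨ T] (x : Fin n → M),
      (∀ χ ∈ Γ, Holds χ x) → Holds φ x) : Der T Γ φ := by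
  by_contra hφ
  -- The free variables of `φ` belong to the context of the condition, so in the term model they
  -- denote the classes of their own numbers; no new constants are needed.
  let s : Condition T := ⟨n, insert (∼φ) Γ, fun h => hφ (.raa h)⟩
  obtain ⟨G, hG⟩ := s.exists_genericIdeal
  have key : ∀ χ ∈ insert (∼φ) Γ, Holds χ (G.val ∘ fun i : Fin n => i.1) := fun χ hχ =>
    (GenericIdeal.holds_iff_forces _ _).2 ⟨s, hG, fun i => i.2, (ren_id χ).symm ▸ .hyp hχ⟩
  exact key _ (Set.mem_insert _ _) (h G.Model _ fun χ hχ => key χ (Set.mem_insert_of_mem _ hχ))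

end Henkin

/-! ### Points of objects of the syntactic category in models of ZF -/

theorem append_comp {α : Type*} {n m : ℕ} (z : Fin (n + m) → α) :
    Fin.append (z ∘ Fin.castAdd m) (z ∘ Fin.natAdd n) = z := by
  funext i
  refine Fin.addCases (fun i => ?_) (fun i => ?_) i <;> simp

theorem append_comp_castAdd {α : Type*} {n m : ℕ} (x : Fin n → α) (y : Fin m → α) :
    Fin.append x y ∘ Fin.castAdd m = x := by
  funext i; simp

theorem append_comp_natAdd {α : Type*} {n m : ℕ} (x : Fin n → α) (y : Fin m → α) :
    Fin.append x y ∘ Fin.natAdd n = y := by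
  funext i; simp

section

variable {X Y Z : ZFCat}

/-- It can be checked in the models of ZF that a formula defines an arrow. -/
theorem IsArrow.of_models {F : Fml (X.arity + Y.arity)}
    (h : ∀ (M : Type) [setLang.Structure M] [Nonempty M] [M ⊨ ZF],
      (∀ (x : Fin X.arity → M) (y : Fin Y.arity → M), Holds F (Fin.append x y) →
        Holds X.fml x ∧ Holds Y.fml y) ∧
      (∀ (x : Fin X.arity → M) (y y' : Fin Y.arity → M), Holds F (Fin.append x y) →
        Holds F (Fin.append x y') → y = y') ∧
      (∀ x : Fin X.arity → M, Holds X.fml x → ∃ y, Holds F (Fin.append x y))) :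
    IsArrow X Y F where
  typed := Der.complete fun M _ _ _ z hz => by
    have hz := hz _ rfl
    rw [← append_comp z] at hz
    have := (h M).1 _ _ hz
    rwa [holds_and, holds_ren, holds_ren]
  single := Der.complete fun M _ _ _ z hz => by
    have hz := hz _ rfl
    rw [holds_and, holds_app, holds_app] at hz
    rw [holds_tupEq]
    exact (h M).2.1 _ _ _ hz.1 hz.2
  total := Der.complete fun M _ _ _ x hx => by
    rw [holds_exs]
    exact (h M).2.2 x (hx _ rfl)

variable (M : Type) [setLang.Structure M]

/-- The points of an object: the lists of elements of the model that satisfy the formula. -/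
abbrev Pts (X : ZFCat) : Type := {x : Fin X.arity → M // Holds X.fml x}

variable {M}

theorem holds_compFml {n m k : ℕ} (F : Fml (n + m)) (G : Fml (m + k)) (x : Fin n → M)
    (z : Fin k → M) : Holds (compFml F G) (Fin.append x z) ↔
      ∃ y, Holds F (Fin.append x y) ∧ Holds G (Fin.append y z) := by
  simp only [compFml, holds_exs, holds_and, holds_app, append_comp_natAdd,
    ← Function.comp_assoc, append_comp_castAdd]

variable [Nonempty M] [M ⊨ ZF]

theorem IsArrow.holds_typed {F : Fml (X.arity + Y.arity)} (hF : IsArrow X Y F)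
    {x : Fin X.arity → M} {y : Fin Y.arity → M} (h : Holds F (Fin.append x y)) :
    Holds X.fml x ∧ Holds Y.fml y := by
  have := hF.typed.sound (Fin.append x y) (by rintro _ rfl; exact h)
  rwa [holds_and, holds_ren, holds_ren, append_comp_castAdd, append_comp_natAdd] at this

theorem IsArrow.holds_single {F : Fml (X.arity + Y.arity)} (hF : IsArrow X Y F)
    {x : Fin X.arity → M} {y y' : Fin Y.arity → M} (h : Holds F (Fin.append x y))
    (h' : Holds F (Fin.append x y')) : y = y' := by
  have := hF.single.sound (Fin.append (Fin.append x y) y') (by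
    rintro _ rfl
    simp only [holds_and, holds_app, append_comp_natAdd, ← Function.comp_assoc,
      append_comp_castAdd]
    exact ⟨h, h'⟩)
  simpa only [holds_tupEq, append_comp_natAdd, ← Function.comp_assoc,
    append_comp_castAdd] using this

theorem IsArrow.holds_total {F : Fml (X.arity + Y.arity)} (hF : IsArrow X Y F)
    {x : Fin X.arity → M} (h : Holds X.fml x) : ∃ y, Holds F (Fin.append x y) := by
  have := hF.total.sound x (by rintro _ rfl; exact h)
  rwa [holds_exs] at this

theorem exists_arrow_eq (f : X ⟶ Y) : ∃ (F : _) (hF : IsArrow X Y F), f = arrow hF :=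
  Quotient.inductionOn f fun F => ⟨F.1, F.2, rfl⟩

/-- The graph of an arrow in a model of ZF. -/
def Graph (f : X ⟶ Y) (x : Fin X.arity → M) (y : Fin Y.arity → M) : Prop :=
  Quotient.liftOn f (fun F => Holds F.1 (Fin.append x y)) fun F G h => by
    -- By soundness, provably equivalent formulas have the same graph.
    have := Der.sound (M := M) h (Fin.append x y) (fun _ hχ => hχ.elim)
    exact propext ((holds_iff _ _ _).1 this)

theorem existsUnique_graph (f : X ⟶ Y) (x : Pts M X) : ∃! y : Pts M Y, Graph f x.1 y.1 := by
  obtain ⟨F, hF, rfl⟩ := exists_arrow_eq f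
  obtain ⟨y, hy⟩ := hF.holds_total x.2
  exact ⟨⟨y, (hF.holds_typed hy).2⟩, hy, fun y' hy' => Subtype.ext (hF.holds_single hy' hy)⟩

/-- The function on points defined by an arrow. -/
noncomputable def ev (f : X ⟶ Y) (x : Pts M X) : Pts M Y := (existsUnique_graph f x).choose

theorem ev_eq_iff {f : X ⟶ Y} {x : Pts M X} {y : Pts M Y} : ev f x = y ↔ Graph f x.1 y.1 :=
  ⟨fun h => h ▸ (existsUnique_graph f x).choose_spec.1,
    fun h => ((existsUnique_graph f x).choose_spec.2 y h).symm⟩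

theorem ev_arrow_eq_iff {F : Fml (X.arity + Y.arity)} {hF : IsArrow X Y F} {x : Pts M X}
    {y : Pts M Y} : ev (arrow hF) x = y ↔ Holds F (Fin.append x.1 y.1) := ev_eq_iff

theorem holds_ev_arrow {F : Fml (X.arity + Y.arity)} (hF : IsArrow X Y F) (x : Pts M X) :
    Holds F (Fin.append x.1 (ev (arrow hF) x).1) := ev_arrow_eq_iff.1 rfl

/-- Together with `ev_id` this makes the points in `M` a functor to sets, so equations between
composites can be computed on points. -/
theorem ev_comp (f : X ⟶ Y) (g : Y ⟶ Z) (x : Pts M X) : ev (f ≫ g) x = ev g (ev f x) := by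
  obtain ⟨F, hF, rfl⟩ := exists_arrow_eq f
  obtain ⟨G, hG, rfl⟩ := exists_arrow_eq g
  change ev (arrow (isArrow_comp hF hG)) x = _
  rw [ev_arrow_eq_iff, holds_compFml]
  exact ⟨_, holds_ev_arrow hF x, holds_ev_arrow hG _⟩

theorem ev_id (x : Pts M X) : ev (𝟙 X) x = x := by
  change ev (arrow (isArrow_id X)) x = _
  rw [ev_arrow_eq_iff, idFml, holds_and, holds_tupEq, holds_ren, append_comp_castAdd,
    append_comp_natAdd]
  exact ⟨rfl, x.2⟩

/-- Arrows are equal if they define the same functions on points. -/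
theorem hom_ext_of_models {f g : X ⟶ Y} (h : ∀ (M : Type) [setLang.Structure M] [Nonempty M]
    [M ⊨ ZF] (x : Pts M X), ev f x = ev g x) : f = g := by
  obtain ⟨F, hF, rfl⟩ := exists_arrow_eq f
  obtain ⟨G, hG, rfl⟩ := exists_arrow_eq g
  -- One implication between functional relations suffices, and completeness reduces it to models.
  refine ZFCat.Hom.mk_eq hF hG (Der.complete fun M _ _ _ z hz => ?_)
  have hz := hz _ rfl
  rw [← append_comp z] at hz ⊢
  have ht := hF.holds_typed hz
  have h1 : ev (arrow hF) ⟨_, ht.1⟩ = (⟨_, ht.2⟩ : Pts M Y) := ev_arrow_eq_iff.2 hz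
  rw [h M, ev_arrow_eq_iff] at h1
  exact h1

/-- Arrows can be defined by giving functions on points that are uniformly definable. -/
theorem exists_hom_of_models (F : Fml (X.arity + Y.arity))
    (h : ∀ (M : Type) [setLang.Structure M] [Nonempty M] [M ⊨ ZF],
      ∃ φ : Pts M X → Pts M Y, ∀ x y, Holds F (Fin.append x y) ↔
        ∃ hx : Holds X.fml x, y = (φ ⟨x, hx⟩).1) :
    ∃ f : X ⟶ Y, ∀ (M : Type) [setLang.Structure M] [Nonempty M] [M ⊨ ZF] (x : Pts M X),
      Holds F (Fin.append x.1 (ev f x).1) := by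
  refine ⟨arrow (IsArrow.of_models (F := F) fun M _ _ _ => ?_),
    fun M _ _ _ x => holds_ev_arrow _ x⟩
  obtain ⟨φ, hφ⟩ := h M
  refine ⟨fun x y hxy => ?_, fun x y y' hy hy' => ?_, fun x hx => ⟨_, (hφ x _).2 ⟨hx, rfl⟩⟩⟩
  · obtain ⟨hx, rfl⟩ := (hφ x y).1 hxy
    exact ⟨hx, (φ ⟨x, hx⟩).2⟩
  · obtain ⟨hx, rfl⟩ := (hφ x y).1 hy
    obtain ⟨_, rfl⟩ := (hφ x y').1 hy'
    rfl

end

/-- The converse relation of a formula in two lists of variables. -/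
def swap {n m : ℕ} (F : Fml (n + m)) : Fml (m + n) := app F (Fin.natAdd m) (Fin.castAdd n)

theorem holds_swap {M : Type} [setLang.Structure M] {n m : ℕ} (F : Fml (n + m)) (x : Fin n → M)
    (y : Fin m → M) : Holds (swap F) (Fin.append y x) ↔ Holds F (Fin.append x y) := by
  rw [swap, holds_app, append_comp_natAdd, append_comp_castAdd]

/-! ### Pullbacks in the syntactic category -/

section

variable {P A B C : ZFCat}

/-- A commutative square is a pullback if it is one on points. -/
theorem isPullback_of_models {p : P ⟶ A} {q : P ⟶ B} {f : A ⟶ C} {g : B ⟶ C}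
    (w : ∀ (M : Type) [setLang.Structure M] [Nonempty M] [M ⊨ ZF] (x : Pts M P),
      ev f (ev p x) = ev g (ev q x))
    (h : ∀ (M : Type) [setLang.Structure M] [Nonempty M] [M ⊨ ZF] (a : Pts M A) (b : Pts M B),
      ev f a = ev g b → ∃ x, ev p x = a ∧ ev q x = b)
    (h' : ∀ (M : Type) [setLang.Structure M] [Nonempty M] [M ⊨ ZF] (x x' : Pts M P),
      ev p x = ev p x' → ev q x = ev q x' → x = x') : IsPullback p q f g := by
  have w : p ≫ f = q ≫ g := hom_ext_of_models fun M _ _ _ x => by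
    rw [ev_comp, ev_comp, w]
  have hlift (s : PullbackCone f g) : ∃ l : s.pt ⟶ P, l ≫ p = s.fst ∧ l ≫ q = s.snd := by
    obtain ⟨Fa, hFa, ha⟩ := exists_arrow_eq s.fst
    obtain ⟨Fb, hFb, hb⟩ := exists_arrow_eq s.snd
    obtain ⟨Fp, hFp, rfl⟩ := exists_arrow_eq p
    obtain ⟨Fq, hFq, rfl⟩ := exists_arrow_eq q
    -- The mediating arrow is defined by the formula saying that the image of `y` under `p` is the
    -- first component of the cone at `x`, and its image under `q` is the second.
    have H (M : Type) [setLang.Structure M] [Nonempty M] [M ⊨ ZF] (x : Fin s.pt.arity → M)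
        (y : Fin P.arity → M) : Holds (compFml Fa (swap Fp) ⊓ compFml Fb (swap Fq))
          (Fin.append x y) ↔ ∃ (hx : Holds s.pt.fml x) (hy : Holds P.fml y),
            ev (arrow hFp) ⟨y, hy⟩ = ev s.fst ⟨x, hx⟩ ∧
              ev (arrow hFq) ⟨y, hy⟩ = ev s.snd ⟨x, hx⟩ := by
      rw [holds_and, holds_compFml, holds_compFml]
      simp only [holds_swap]
      constructor
      · rintro ⟨⟨a, h1, h2⟩, ⟨b, h3, h4⟩⟩
        have hx := (hFa.holds_typed h1).1
        have hy := (hFp.holds_typed h2).1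
        have e1 : ev s.fst ⟨x, hx⟩ = ⟨a, (hFa.holds_typed h1).2⟩ := by
          rw [ha]; exact ev_arrow_eq_iff.2 h1
        have e2 : ev s.snd ⟨x, hx⟩ = ⟨b, (hFb.holds_typed h3).2⟩ := by
          rw [hb]; exact ev_arrow_eq_iff.2 h3
        refine ⟨hx, hy, ?_, ?_⟩
        · rw [e1]; exact ev_arrow_eq_iff.2 h2
        · rw [e2]; exact ev_arrow_eq_iff.2 h4
      · rintro ⟨hx, hy, h1, h2⟩
        rw [ha] at h1
        rw [hb] at h2
        refine ⟨⟨_, holds_ev_arrow hFa ⟨x, hx⟩, ?_⟩, ⟨_, holds_ev_arrow hFb ⟨x, hx⟩, ?_⟩⟩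
        · rw [← h1]; exact holds_ev_arrow hFp ⟨y, hy⟩
        · rw [← h2]; exact holds_ev_arrow hFq ⟨y, hy⟩
    obtain ⟨l, hl⟩ := exists_hom_of_models (X := s.pt) (Y := P) _ fun M _ _ _ => by
      have hw (x : Pts M s.pt) : ev f (ev s.fst x) = ev g (ev s.snd x) := by
        rw [← ev_comp, s.condition, ev_comp]
      -- The choice is made in each model separately. By the joint injectivity `h'` the chosen
      -- function is the only possible one, so its graph is given by the uniform formula above.
      choose φ h1 h2 using fun x : Pts M s.pt => h M (ev s.fst x) (ev s.snd x) (hw x)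
      refine ⟨φ, fun x y => (H M x y).trans ?_⟩
      constructor
      · rintro ⟨hx, hy, e1, e2⟩
        exact ⟨hx, congrArg Subtype.val (h' M ⟨y, hy⟩ (φ ⟨x, hx⟩) (e1.trans (h1 _).symm)
          (e2.trans (h2 _).symm))⟩
      · rintro ⟨hx, rfl⟩
        exact ⟨hx, (φ ⟨x, hx⟩).2, h1 _, h2 _⟩
    refine ⟨l, hom_ext_of_models fun M _ _ _ x => ?_, hom_ext_of_models fun M _ _ _ x => ?_⟩
    · obtain ⟨_, _, h1, _⟩ := (H M _ _).1 (hl M x)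
      rw [ev_comp]; exact h1
    · obtain ⟨_, _, _, h2⟩ := (H M _ _).1 (hl M x)
      rw [ev_comp]; exact h2
  choose l h1 h2 using hlift
  refine .of_isLimit (PullbackCone.IsLimit.mk w l h1 h2 fun s m hm1 hm2 => ?_)
  refine hom_ext_of_models fun M _ _ _ x => h' M _ _ ?_ ?_
  · rw [← ev_comp, ← ev_comp, hm1, h1]
  · rw [← ev_comp, ← ev_comp, hm2, h2]

/-- The pullback is `{x, y | ∃ z (F(x, z) ∧ G(y, z))}` with the two coordinate projections. It is
used for the object of composable triples. -/
theorem hasPullback (f : A ⟶ C) (g : B ⟶ C) : HasPullback f g := by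
  obtain ⟨F, hF, rfl⟩ := exists_arrow_eq f
  obtain ⟨G, hG, rfl⟩ := exists_arrow_eq g
  let P : ZFCat := ⟨A.arity + B.arity, compFml F (swap G)⟩
  have hP (M : Type) [setLang.Structure M] [Nonempty M] [M ⊨ ZF] (x : Fin A.arity → M)
      (y : Fin B.arity → M) : Holds P.fml (Fin.append x y) ↔
        ∃ (hx : Holds A.fml x) (hy : Holds B.fml y),
          ev (arrow hF) ⟨x, hx⟩ = ev (arrow hG) ⟨y, hy⟩ := by
    refine (holds_compFml _ _ _ _).trans ?_
    simp only [holds_swap]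
    constructor
    · rintro ⟨z, h1, h2⟩
      have e1 : ev (arrow hF) ⟨x, (hF.holds_typed h1).1⟩ = ⟨z, (hF.holds_typed h1).2⟩ :=
        ev_arrow_eq_iff.2 h1
      exact ⟨_, (hG.holds_typed h2).1, e1.trans (ev_arrow_eq_iff.2 h2).symm⟩
    · rintro ⟨hx, hy, h⟩
      refine ⟨_, holds_ev_arrow hF ⟨x, hx⟩, ?_⟩
      rw [h]
      exact holds_ev_arrow hG ⟨y, hy⟩
  obtain ⟨p, hp⟩ := exists_hom_of_models (X := P) (Y := A) (ren (Fin.castAdd A.arity) P.fml ⊓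
      tupEq (Fin.castAdd A.arity ∘ Fin.castAdd B.arity) (Fin.natAdd P.arity)) fun M _ _ _ => by
    refine ⟨fun x => ⟨x.1 ∘ Fin.castAdd B.arity, ?_⟩, fun x y => ?_⟩
    · have := x.2
      rw [← append_comp x.1, hP M] at this
      exact this.1
    · rw [holds_and, holds_ren, holds_tupEq, ← Function.comp_assoc, append_comp_castAdd,
        append_comp_natAdd]
      exact ⟨fun h => ⟨h.1, h.2.symm⟩, fun ⟨h, e⟩ => ⟨h, e.symm⟩⟩
  obtain ⟨q, hq⟩ := exists_hom_of_models (X := P) (Y := B) (ren (Fin.castAdd B.arity) P.fml ⊓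
      tupEq (Fin.castAdd B.arity ∘ Fin.natAdd A.arity) (Fin.natAdd P.arity)) fun M _ _ _ => by
    refine ⟨fun x => ⟨x.1 ∘ Fin.natAdd A.arity, ?_⟩, fun x y => ?_⟩
    · have := x.2
      rw [← append_comp x.1, hP M] at this
      exact this.2.1
    · rw [holds_and, holds_ren, holds_tupEq, ← Function.comp_assoc, append_comp_castAdd,
        append_comp_natAdd]
      exact ⟨fun h => ⟨h.1, h.2.symm⟩, fun ⟨h, e⟩ => ⟨h, e.symm⟩⟩
  have hp' (M : Type) [setLang.Structure M] [Nonempty M] [M ⊨ ZF] (x : Pts M P) :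
      x.1 ∘ Fin.castAdd B.arity = (ev p x).1 := by
    have := hp M x
    rw [holds_and, holds_tupEq, ← Function.comp_assoc, append_comp_castAdd,
      append_comp_natAdd] at this
    exact this.2
  have hq' (M : Type) [setLang.Structure M] [Nonempty M] [M ⊨ ZF] (x : Pts M P) :
      x.1 ∘ Fin.natAdd A.arity = (ev q x).1 := by
    have := hq M x
    rw [holds_and, holds_tupEq, ← Function.comp_assoc, append_comp_castAdd,
      append_comp_natAdd] at this
    exact this.2
  refine (isPullback_of_models (p := p) (q := q) (fun M _ _ _ x => ?_) (fun M _ _ _ a b hab => ?_)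
    fun M _ _ _ x x' h1 h2 => ?_).hasPullback
  · have := x.2
    rw [← append_comp x.1, hP M] at this
    obtain ⟨h1, h2, h⟩ := this
    rwa [show ev p x = ⟨_, h1⟩ from Subtype.ext (hp' M x).symm,
      show ev q x = ⟨_, h2⟩ from Subtype.ext (hq' M x).symm]
  · refine ⟨⟨Fin.append a.1 b.1, (hP M _ _).2 ⟨a.2, b.2, hab⟩⟩, Subtype.ext ?_, Subtype.ext ?_⟩
    · rw [← hp' M]; exact append_comp_castAdd _ _
    · rw [← hq' M]; exact append_comp_natAdd _ _
  · refine Subtype.ext ?_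
    rw [← append_comp x.1, ← append_comp x'.1]
    have e1 := (hp' M x).trans ((congrArg Subtype.val h1).trans (hp' M x').symm)
    have e2 := (hq' M x).trans ((congrArg Subtype.val h2).trans (hq' M x').symm)
    exact congrArg₂ Fin.append e1 e2

end

/-! ### Set theory in a model of ZF -/

section

variable {M : Type} [setLang.Structure M] [M ⊨ ZF]

theorem holds_of_isZFAxiom {φ : setLang.Sentence} (h : IsZFAxiom φ) :
    Holds (M := M) (n := 0) φ default :=
  Theory.realize_sentence_of_mem (M := M) ZF h

theorem E_ext {a b : M} (h : ∀ t, E t a ↔ E t b) : a = b := by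
  have := holds_of_isZFAxiom (M := M) .ext
  simp only [axExt, holds_all, holds_imp, holds_iff, holds_mem, holds_eq] at this
  exact this a b h

theorem exists_upair (a b : M) : ∃ c : M, ∀ t, E t c ↔ t = a ∨ t = b := by
  have := holds_of_isZFAxiom (M := M) .pair
  simp only [axPair, holds_all, holds_ex, holds_iff, holds_or, holds_mem, holds_eq] at this
  exact this a b

/-- The unordered pair in a model of ZF. -/
noncomputable def upair (a b : M) : M := (exists_upair a b).choose

@[simp] theorem E_upair {a b t : M} : E t (upair a b) ↔ t = a ∨ t = b :=
  (exists_upair a b).choose_spec t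

theorem upair_inj_right {a b c : M} (h : upair a b = upair a c) : b = c := by
  have hb : E b (upair a c) := h ▸ E_upair.2 (.inr rfl)
  have hc : E c (upair a b) := h ▸ E_upair.2 (.inr rfl)
  rcases E_upair.1 hb with rfl | h1
  · rcases E_upair.1 hc with h2 | h2 <;> exact h2.symm
  · exact h1

/-- The ordered pair in a model of ZF. -/
noncomputable def pair (a b : M) : M := upair (upair a a) (upair a b)

/-- Since `{a}` equals `{c}` or `{c, d}`, in either case `c ∈ {a}`, which gives `a = c`. The second
components are then found by cancelling in unordered pairs twice. -/
theorem pair_inj {a b c d : M} : pair a b = pair c d ↔ a = c ∧ b = d := by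
  refine ⟨fun h => ?_, fun ⟨h, h'⟩ => h ▸ h' ▸ rfl⟩
  obtain rfl : a = c := by
    have h1 : E (upair a a) (pair c d) := h ▸ E_upair.2 (.inl rfl)
    have h2 : E c (upair a a) := by
      rcases E_upair.1 h1 with h1 | h1 <;> rw [h1] <;> exact E_upair.2 (.inl rfl)
    exact ((or_self_iff).1 (E_upair.1 h2)).symm
  exact ⟨rfl, upair_inj_right (upair_inj_right h)⟩

theorem holds_isUPair (x : Fin 3 → M) : Holds isUPair x ↔ x 0 = upair (x 1) (x 2) := by
  simp only [isUPair, holds_all, holds_iff, holds_or, holds_mem, holds_eq]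
  exact ⟨fun h => E_ext fun t => (h t).trans E_upair.symm, fun h t => (h ▸ E_upair :)⟩

theorem holds_isPair (x : Fin 3 → M) : Holds isPair x ↔ x 0 = pair (x 1) (x 2) := by
  simp only [isPair, holds_ex, holds_and, holds_ren, holds_isUPair]
  constructor
  · rintro ⟨a, b, ⟨ha, hb⟩, h⟩
    obtain rfl : a = upair (x 1) (x 1) := ha
    obtain rfl : b = upair (x 1) (x 2) := hb
    exact h
  · exact fun h => ⟨_, _, ⟨rfl, rfl⟩, h⟩

theorem holds_pairMem (x : Fin 3 → M) : Holds pairMem x ↔ E (pair (x 0) (x 1)) (x 2) := by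
  simp only [pairMem, holds_ex, holds_and, holds_ren, holds_isPair, holds_mem]
  constructor
  · rintro ⟨a, ha, h⟩
    obtain rfl : a = pair (x 0) (x 1) := ha
    exact h
  · exact fun h => ⟨_, rfl, h⟩

theorem holds_isTriple (x : Fin 4 → M) :
    Holds isTriple x ↔ x 0 = pair (x 1) (pair (x 2) (x 3)) := by
  simp only [isTriple, holds_ex, holds_and, holds_ren, holds_isPair]
  constructor
  · rintro ⟨a, ha, h⟩
    obtain rfl : a = pair (x 2) (x 3) := ha
    exact h
  · exact fun h => ⟨_, rfl, h⟩

/-- Single-valued sets of ordered pairs. -/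
def IsFn (f : M) : Prop :=
  (∀ p, E p f → ∃ a b, p = pair a b) ∧ ∀ a b c, E (pair a b) f ∧ E (pair a c) f → b = c

theorem holds_isFun (x : Fin 1 → M) : Holds isFun x ↔ IsFn (x 0) := by
  simp only [isFun, holds_ex, holds_all, holds_imp, holds_and, holds_ren, holds_isPair, holds_mem,
    holds_pairMem, holds_eq]
  rfl

/-- The range of the first set is contained in the second one. -/
def RanSub (f z : M) : Prop := ∀ b, (∃ a, E (pair a b) f) → E b z

theorem holds_ranSub (x : Fin 2 → M) : Holds ranSub x ↔ RanSub (x 0) (x 1) := by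
  simp only [ranSub, holds_ex, holds_all, holds_imp, holds_ren, holds_mem, holds_pairMem]
  rfl

-- For the axiom schemes: the variables after the `k` parameters are collected in one appended list,
-- so that the indices `Fin.natAdd k i` can be evaluated.
omit [setLang.Structure M] [M ⊨ ZF] in
theorem snoc_eq_append {k : ℕ} (x : Fin k → M) (a : M) :
    (Fin.snoc x a : Fin (k + 1) → M) = Fin.append x ![a] :=
  (Fin.append_right_eq_snoc x ![a]).symm

omit [setLang.Structure M] [M ⊨ ZF] in
theorem append_snoc_eq {k m : ℕ} (x : Fin k → M) (y : Fin m → M) (a : M) :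
    (Fin.snoc (Fin.append x y) a : Fin (k + m + 1) → M) =
      Fin.append x (Fin.snoc y a : Fin (m + 1) → M) := (Fin.append_snoc x y a).symm

theorem exists_sep {k : ℕ} (P : Fml (k + 1)) (x : Fin k → M) (z : M) :
    ∃ w : M, ∀ t, E t w ↔ E t z ∧ Holds P (Fin.append x ![t]) := by
  have := holds_of_isZFAxiom (M := M) (.sep P)
  have := BoundedFormula.realize_alls.1 this x
  obtain ⟨w, hw⟩ := (holds_ex _ _).1 ((holds_all _ _).1 this z)
  refine ⟨w, fun t => ?_⟩
  have h := (holds_all _ _).1 hw t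
  rw [snoc_eq_append x z, append_snoc_eq (m := 1), append_snoc_eq (m := 2), holds_iff, holds_and,
    holds_mem, holds_mem, holds_app, Fin.append_right, Fin.append_right, Fin.append_right,
    append_comp_castAdd] at h
  have e : Fin.append x (Fin.snoc (Fin.snoc ![z] w : Fin 2 → M) t : Fin 3 → M) ∘
      ![Fin.natAdd k 2] = ![t] := by
    funext i
    fin_cases i
    exact Fin.append_right _ _ _
  rw [e] at h
  exact h

/-- Images of sets under definable functions are sets. -/
theorem exists_image {k : ℕ} (F : Fml (k + 2)) (x : Fin k → M) (z : M)
    (h : ∀ a, E a z → ∃ b, Holds F (Fin.append x ![a, b]) ∧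
      ∀ b', Holds F (Fin.append x ![a, b']) → b' = b) :
    ∃ w : M, ∀ b, E b w ↔ ∃ a, E a z ∧ Holds F (Fin.append x ![a, b]) := by
  have e3 (a b : M) (y : Fin 3 → M) (i j : Fin 3) (hi : y i = a) (hj : y j = b) :
      Fin.append x y ∘ ![Fin.natAdd k i, Fin.natAdd k j] = ![a, b] := by
    funext l
    fin_cases l
    · exact (Fin.append_right _ _ _).trans hi
    · exact (Fin.append_right _ _ _).trans hj
  have e4 (a b : M) (y : Fin 4 → M) (i j : Fin 4) (hi : y i = a) (hj : y j = b) :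
      Fin.append x y ∘ ![Fin.natAdd k i, Fin.natAdd k j] = ![a, b] := by
    funext l
    fin_cases l
    · exact (Fin.append_right _ _ _).trans hi
    · exact (Fin.append_right _ _ _).trans hj
  have hr := holds_of_isZFAxiom (M := M) (.repl F)
  have hr := BoundedFormula.realize_alls.1 hr x
  have hr := (holds_all _ _).1 hr z
  rw [holds_imp, holds_all, holds_ex] at hr
  obtain ⟨w, hw⟩ := hr fun a => by
    rw [holds_imp, holds_mem, holds_ex, snoc_eq_append x z, append_snoc_eq (m := 1),
      Fin.append_right, Fin.append_right]
    intro ha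
    obtain ⟨b, hb, hb'⟩ := h a ha
    refine ⟨b, ?_⟩
    rw [append_snoc_eq (m := 2), holds_and, holds_app, append_comp_castAdd, e3 a b _ _ _ rfl rfl,
      holds_all]
    refine ⟨hb, fun b' => ?_⟩
    rw [append_snoc_eq (m := 3), holds_imp, holds_app, append_comp_castAdd,
      e4 a b' _ _ _ rfl rfl, holds_eq, Fin.append_right, Fin.append_right]
    exact hb' b'
  have hw' (a : M) (ha : E a z) : ∃ b, E b w ∧ Holds F (Fin.append x ![a, b]) := by
    have := (holds_all _ _).1 hw a
    rw [holds_imp, holds_mem, holds_ex, snoc_eq_append x z, append_snoc_eq (m := 1),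
      append_snoc_eq (m := 2), Fin.append_right, Fin.append_right] at this
    obtain ⟨b, hb⟩ := this ha
    rw [append_snoc_eq (m := 3), holds_and, holds_app, append_comp_castAdd,
      e4 a b _ _ _ rfl rfl, holds_mem, Fin.append_right, Fin.append_right] at hb
    exact ⟨b, hb⟩
  -- Replacement only gives a set `w` that contains the image; separation cuts it down. In `P` the
  -- variables after the parameters are `z`, the value `b` and the bound argument `a`.
  let P : Fml (k + 1 + 1) := ∃' (mem (n := k + 3) (Fin.natAdd k 2) (Fin.natAdd k 0) ⊓
    app (N := k + 3) F (Fin.castAdd 3) ![Fin.natAdd k 2, Fin.natAdd k 1])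
  obtain ⟨v, hv⟩ := exists_sep P (Fin.append x ![z]) w
  refine ⟨v, fun b => (hv b).trans ?_⟩
  have key : Holds P (Fin.append (Fin.append x ![z]) ![b]) ↔
      ∃ a, E a z ∧ Holds F (Fin.append x ![a, b]) := by
    rw [← snoc_eq_append (Fin.append x ![z]), append_snoc_eq (m := 1), holds_ex]
    refine exists_congr fun a => ?_
    rw [append_snoc_eq (m := 2), holds_and, holds_mem, holds_app, append_comp_castAdd,
      e3 a b _ _ _ rfl rfl, Fin.append_right, Fin.append_right]
    rfl
  rw [key]
  refine ⟨And.right, fun ⟨a, ha, hb⟩ => ⟨?_, a, ha, hb⟩⟩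
  -- Every value `b` lies in `w`: replacement puts some value at `a` into `w`, and the value at `a`
  -- is unique.
  obtain ⟨b', hb', h'⟩ := hw' a ha
  obtain ⟨c, -, hc⟩ := h a ha
  rwa [hc b hb, ← hc b' h']

/-! ### Domains, identities and composites in a model of ZF -/

variable [Nonempty M]

/-- The domain of a function. -/
noncomputable def dom (f : M) : M := Classical.epsilon fun d => ∀ a, E a d ↔ ∃ b, E (pair a b) f

/-- The `epsilon` term is meaningful once such a set exists. It is the image of `f` under the first
projection, which is total on `f` because all elements of `f` are pairs. -/
theorem IsFn.E_dom {f : M} (hf : IsFn f) {a : M} : E a (dom f) ↔ ∃ b, E (pair a b) f := by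
  refine Classical.epsilon_spec (p := fun d => ∀ a, E a d ↔ ∃ b, E (pair a b) f) ?_ a
  have hF (p t : M) : Holds (M := M) (∃' (ren ![0, 1, 2] isPair) : Fml (0 + 2))
      (Fin.append ![] ![p, t]) ↔ ∃ b, p = pair t b := by
    simp only [holds_ex, holds_ren, holds_isPair]
    rfl
  obtain ⟨d, hd⟩ := exists_image (M := M) (∃' (ren ![0, 1, 2] isPair) : Fml (0 + 2)) ![] f
    fun p hp => by
      simp only [hF]
      obtain ⟨a, b, rfl⟩ := hf.1 p hp
      exact ⟨a, ⟨b, rfl⟩, fun a' ⟨b', h⟩ => (pair_inj.1 h).1.symm⟩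
  refine ⟨d, fun a => (hd a).trans ?_⟩
  simp only [hF]
  constructor
  · rintro ⟨_, h, b, rfl⟩
    exact ⟨b, h⟩
  · rintro ⟨b, h⟩
    exact ⟨_, h, b, rfl⟩

theorem holds_isDom {x : Fin 2 → M} (hf : IsFn (x 0)) : Holds isDom x ↔ x 1 = dom (x 0) := by
  simp only [isDom, holds_ex, holds_all, holds_iff, holds_ren, holds_mem, holds_pairMem]
  exact ⟨fun h => E_ext fun t => (h t).trans hf.E_dom.symm, fun h t => (h ▸ hf.E_dom :)⟩

/-- The identity function of a set. -/
noncomputable def ident (x : M) : M :=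
  Classical.epsilon fun f => ∀ t, E t f ↔ ∃ s, E s x ∧ t = pair s s

/-- The set is the image of `x` under `s ↦ ⟨s, s⟩`. -/
theorem E_ident {x t : M} : E t (ident x) ↔ ∃ s, E s x ∧ t = pair s s := by
  refine Classical.epsilon_spec (p := fun f => ∀ t, E t f ↔ ∃ s, E s x ∧ t = pair s s) ?_ t
  have hF (s t : M) : Holds (M := M) (ren ![1, 0, 0] isPair : Fml (0 + 2))
      (Fin.append ![] ![s, t]) ↔ t = pair s s := by
    simp only [holds_ren, holds_isPair]
    rfl
  have := exists_image (M := M) (ren ![1, 0, 0] isPair : Fml (0 + 2)) ![] x fun s _ => by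
    simp only [hF]
    exact ⟨_, rfl, fun _ => id⟩
  simpa only [hF] using this

theorem E_pair_ident {x a b : M} : E (pair a b) (ident x) ↔ E a x ∧ a = b := by
  rw [E_ident]
  constructor
  · rintro ⟨s, hs, h⟩
    obtain ⟨rfl, rfl⟩ := pair_inj.1 h
    exact ⟨hs, rfl⟩
  · rintro ⟨h, rfl⟩
    exact ⟨a, h, rfl⟩

/-- The composite of two functions. -/
noncomputable def comp (f g : M) : M :=
  Classical.epsilon fun h => ∀ t, E t h ↔ ∃ a b c, (E (pair a b) f ∧ E (pair b c) g) ∧ t = pair a c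

/-- The set is a function whose values are in the second set. -/
def IsMap (f z : M) : Prop := IsFn f ∧ RanSub f z

/-- The composite is the image of `f` under `⟨a, b⟩ ↦ ⟨a, g(b)⟩`. This map is total on `f` because
the range of `f` is contained in the domain of `g`, and single-valued because `g` is. -/
theorem IsMap.E_comp {f g : M} (hf : IsMap f (dom g)) (hg : IsFn g) {t : M} :
    E t (comp f g) ↔ ∃ a b c, (E (pair a b) f ∧ E (pair b c) g) ∧ t = pair a c := by
  refine Classical.epsilon_spec (p := fun h => ∀ t, E t h ↔
    ∃ a b c, (E (pair a b) f ∧ E (pair b c) g) ∧ t = pair a c) ?_ t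
  -- The variables are the parameter `g`, the argument `p`, the value `t`, and then the bound `a`,
  -- `b`, `c`.
  let F : Fml (1 + 2) := ∃' ∃' ∃' (ren ![1, 3, 4] isPair ⊓ ren ![4, 5, 0] pairMem ⊓
    ren ![2, 3, 5] isPair)
  have hF (p t : M) : Holds F (Fin.append ![g] ![p, t]) ↔
      ∃ a b c, (p = pair a b ∧ E (pair b c) g) ∧ t = pair a c := by
    simp only [F, holds_ex, holds_and, holds_ren, holds_isPair, holds_pairMem]
    rfl
  obtain ⟨h, hh⟩ := exists_image F ![g] f fun p hp => by
    simp only [hF]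
    obtain ⟨a, b, rfl⟩ := hf.1.1 p hp
    obtain ⟨c, hc⟩ := hg.E_dom.1 (hf.2 b ⟨a, hp⟩)
    refine ⟨pair a c, ⟨a, b, c, ⟨rfl, hc⟩, rfl⟩, ?_⟩
    rintro _ ⟨a', b', c', ⟨h, hc'⟩, rfl⟩
    obtain ⟨rfl, rfl⟩ := pair_inj.1 h
    rw [hg.2 _ _ _ ⟨hc, hc'⟩]
  refine ⟨h, fun t => (hh t).trans ?_⟩
  simp only [hF]
  constructor
  · rintro ⟨_, hp, a, b, c, ⟨rfl, hc⟩, rfl⟩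
    exact ⟨a, b, c, ⟨hp, hc⟩, rfl⟩
  · rintro ⟨a, b, c, ⟨hp, hc⟩, rfl⟩
    exact ⟨_, hp, a, b, c, ⟨rfl, hc⟩, rfl⟩

theorem IsMap.E_pair_comp {f g : M} (hf : IsMap f (dom g)) (hg : IsFn g) {a c : M} :
    E (pair a c) (comp f g) ↔ ∃ b, E (pair a b) f ∧ E (pair b c) g := by
  rw [hf.E_comp hg]
  constructor
  · rintro ⟨a', b, c', h, e⟩
    obtain ⟨rfl, rfl⟩ := pair_inj.1 e
    exact ⟨b, h⟩
  · rintro ⟨b, h⟩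
    exact ⟨a, b, c, h, rfl⟩

omit [Nonempty M] in
theorem IsFn.ext {f g : M} (hf : IsFn f) (hg : IsFn g)
    (h : ∀ a b, E (pair a b) f ↔ E (pair a b) g) : f = g := by
  refine E_ext fun t => ⟨fun ht => ?_, fun ht => ?_⟩
  · obtain ⟨a, b, rfl⟩ := hf.1 t ht
    exact (h a b).1 ht
  · obtain ⟨a, b, rfl⟩ := hg.1 t ht
    exact (h a b).2 ht

theorem isMap_ident (x : M) : IsMap (ident x) x := by
  refine ⟨⟨fun p hp => ?_, fun a b c h => ?_⟩, fun b ⟨a, h⟩ => ?_⟩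
  · obtain ⟨s, -, rfl⟩ := E_ident.1 hp
    exact ⟨s, s, rfl⟩
  · exact (E_pair_ident.1 h.1).2.symm.trans (E_pair_ident.1 h.2).2
  · obtain ⟨h, rfl⟩ := E_pair_ident.1 h
    assumption

theorem dom_ident (x : M) : dom (ident x) = x := by
  refine E_ext fun a => (isMap_ident x).1.E_dom.trans ?_
  simp only [E_pair_ident, exists_and_left, exists_eq', and_true]

theorem IsMap.comp {f g z : M} (hf : IsMap f (dom g)) (hg : IsMap g z) : IsMap (comp f g) z := by
  refine ⟨⟨fun p hp => ?_, fun a b c h => ?_⟩, fun c ⟨a, h⟩ => ?_⟩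
  · obtain ⟨a, b, c, -, rfl⟩ := (hf.E_comp hg.1).1 hp
    exact ⟨a, c, rfl⟩
  · obtain ⟨s, h1, h2⟩ := (hf.E_pair_comp hg.1).1 h.1
    obtain ⟨s', h1', h2'⟩ := (hf.E_pair_comp hg.1).1 h.2
    obtain rfl := hf.1.2 _ _ _ ⟨h1, h1'⟩
    exact hg.1.2 _ _ _ ⟨h2, h2'⟩
  · obtain ⟨b, -, h⟩ := (hf.E_pair_comp hg.1).1 h
    exact hg.2 c ⟨b, h⟩

/-- No argument of `f` is lost, since each of its values is an argument of `g`. -/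
theorem IsMap.dom_comp {f g z : M} (hf : IsMap f (dom g)) (hg : IsMap g z) :
    dom (ZFSyn.comp f g) = dom f := by
  refine E_ext fun a => ((hf.comp hg).1.E_dom.trans ?_).trans hf.1.E_dom.symm
  simp only [hf.E_pair_comp hg.1]
  constructor
  · rintro ⟨c, b, h, -⟩
    exact ⟨b, h⟩
  · rintro ⟨b, h⟩
    obtain ⟨c, hc⟩ := hg.1.E_dom.1 (hf.2 b ⟨a, h⟩)
    exact ⟨c, b, h, hc⟩

theorem IsMap.ident_comp {f z : M} (hf : IsMap f z) : ZFSyn.comp (ident (dom f)) f = f := by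
  refine ((isMap_ident _).comp hf).1.ext hf.1 fun a b => ?_
  rw [(isMap_ident _).E_pair_comp hf.1]
  constructor
  · rintro ⟨a', h, h'⟩
    obtain ⟨-, rfl⟩ := E_pair_ident.1 h
    exact h'
  · exact fun h => ⟨a, E_pair_ident.2 ⟨hf.1.E_dom.2 ⟨b, h⟩, rfl⟩, h⟩

/-- The identity is that of the codomain `z`, which may exceed the range of `f`; only the
containment of the range in `z` matters. -/
theorem IsMap.comp_ident {f z : M} (hf : IsMap f z) : ZFSyn.comp f (ident z) = f := by
  have hf' : IsMap f (dom (ident z)) := by rwa [dom_ident]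
  refine (hf'.comp (isMap_ident _)).1.ext hf.1 fun a b => ?_
  rw [hf'.E_pair_comp (isMap_ident _).1]
  constructor
  · rintro ⟨b', h, h'⟩
    obtain ⟨-, rfl⟩ := E_pair_ident.1 h'
    exact h
  · exact fun h => ⟨b, h, E_pair_ident.2 ⟨hf.2 b ⟨a, h⟩, rfl⟩⟩

theorem IsMap.comp_assoc {f g h z : M} (hf : IsMap f (dom g)) (hg : IsMap g (dom h))
    (hh : IsMap h z) : ZFSyn.comp (ZFSyn.comp f g) h = ZFSyn.comp f (ZFSyn.comp g h) := by
  -- Composability of `f` with the composite of `g` and `h` rests on that composite having the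
  -- domain of `g`.
  have hf' : IsMap f (dom (ZFSyn.comp g h)) := by rwa [hg.dom_comp hh]
  refine ((hf.comp hg).comp hh).1.ext (hf'.comp (hg.comp hh)).1 fun a d => ?_
  rw [(hf.comp hg).E_pair_comp hh.1, hf'.E_pair_comp (hg.comp hh).1]
  simp only [hf.E_pair_comp hg.1, hg.E_pair_comp hh.1]
  constructor
  · rintro ⟨c, ⟨b, h1, h2⟩, h3⟩
    exact ⟨b, h1, c, h2, h3⟩
  · rintro ⟨b, h1, c, h2, h3⟩
    exact ⟨c, ⟨b, h1, h2⟩, h3⟩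

end

/-! ### The category of sets in a model of ZF -/

theorem append_eq_cons {α : Type*} (x y : Fin 1 → α) : Fin.append x y = ![x 0, y 0] := by
  funext i
  fin_cases i <;> rfl

section

variable {M : Type} [setLang.Structure M] [M ⊨ ZF]

theorem holds_isMap (x : Fin 3 → M) :
    Holds isMap x ↔ x 0 = pair (x 1) (x 2) ∧ IsMap (x 1) (x 2) := by
  simp only [isMap, holds_and, holds_ren, holds_isPair, holds_isFun, holds_ranSub, and_assoc]
  rfl

theorem holds_SET₁ (x : Fin 1 → M) :
    Holds (M := M) SET₁.fml x ↔ ∃ f z, x 0 = pair f z ∧ IsMap f z := by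
  refine (holds_ex _ _).trans (exists_congr fun f => (holds_ex _ _).trans (exists_congr fun z => ?_))
  exact holds_isMap _

theorem holds_codFml (F z : M) : Holds codFml ![F, z] ↔ ∃ f, F = pair f z ∧ IsMap f z := by
  simp only [codFml, holds_ex, holds_ren, holds_isMap]
  rfl

variable [Nonempty M]

/-- The formula spells out `ran(f) ⊆ dom(f')` by pairs. It can be restated with the term `dom`
because `Fun(f')` is part of the conjunction. -/
theorem holds_isComposable (x : Fin 4 → M) : Holds isComposable x ↔
    x 0 = pair (x 1) (pair (x 2) (x 3)) ∧ IsMap (x 1) (dom (x 2)) ∧ IsMap (x 2) (x 3) := by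
  simp only [isComposable, ranSubDom, holds_and, holds_ren, holds_isTriple, holds_isFun,
    holds_ranSub, holds_all, holds_imp, holds_ex, holds_pairMem]
  constructor
  · rintro ⟨⟨⟨⟨h, h1⟩, h2⟩, h3⟩, h4⟩
    exact ⟨h, ⟨h1, fun b hb => (IsFn.E_dom h2).2 (h3 b hb)⟩, h2, h4⟩
  · rintro ⟨h, ⟨h1, h3⟩, h2, h4⟩
    exact ⟨⟨⟨⟨h, h1⟩, h2⟩, fun b hb => (IsFn.E_dom h2).1 (h3 b hb)⟩, h4⟩

theorem holds_SET₂ (x : Fin 1 → M) : Holds (M := M) SET₂.fml x ↔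
    ∃ f g z, x 0 = pair f (pair g z) ∧ IsMap f (dom g) ∧ IsMap g z := by
  refine (holds_ex _ _).trans (exists_congr fun f => (holds_ex _ _).trans (exists_congr fun g =>
    (holds_ex _ _).trans (exists_congr fun z => ?_)))
  exact holds_isComposable _

theorem holds_domFml (F x : M) :
    Holds domFml ![F, x] ↔ ∃ f z, (F = pair f z ∧ IsMap f z) ∧ x = dom f := by
  simp only [domFml, holds_ex, holds_and, holds_ren, holds_isMap]
  exact exists_congr fun f => exists_congr fun z => and_congr_right fun h => holds_isDom h.2.1

theorem holds_identFml (x F : M) : Holds identFml ![x, F] ↔ F = pair (ident x) x := by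
  simp only [identFml, holds_ex, holds_and, holds_ren, holds_isPair, holds_all, holds_iff,
    holds_mem]
  constructor
  · rintro ⟨f, h, hf⟩
    obtain rfl : f = ident x := E_ext fun t => (hf t).trans E_ident.symm
    exact h
  · exact fun h => ⟨ident x, h, fun t => E_ident⟩

theorem holds_fstFml (J F : M) : Holds fstFml ![J, F] ↔ ∃ f g z,
    (J = pair f (pair g z) ∧ IsMap f (dom g) ∧ IsMap g z) ∧ F = pair f (dom g) := by
  simp only [fstFml, holds_ex, holds_and, holds_ren, holds_isPair, holds_isComposable]
  refine exists_congr fun f => exists_congr fun g => exists_congr fun z =>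
    and_congr_right fun h => ?_
  constructor
  · rintro ⟨d, hd, hF⟩
    obtain rfl : d = dom g := (holds_isDom h.2.2.1).1 hd
    exact hF
  · exact fun hF => ⟨dom g, (holds_isDom h.2.2.1).2 rfl, hF⟩

theorem holds_sndFml (J F : M) : Holds sndFml ![J, F] ↔ ∃ f g z,
    (J = pair f (pair g z) ∧ IsMap f (dom g) ∧ IsMap g z) ∧ F = pair g z := by
  simp only [sndFml, holds_ex, holds_and, holds_ren, holds_isPair, holds_isComposable]
  rfl

theorem holds_boxFml (J G : M) : Holds boxFml ![J, G] ↔ ∃ f g z,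
    (J = pair f (pair g z) ∧ IsMap f (dom g) ∧ IsMap g z) ∧ G = pair (comp f g) z := by
  simp only [boxFml, holds_ex, holds_and, holds_ren, holds_isPair, holds_isComposable, holds_all,
    holds_iff, holds_mem, holds_pairMem]
  refine exists_congr fun f => exists_congr fun g => exists_congr fun z => ?_
  constructor
  · rintro ⟨h, ⟨hJ, hG⟩, H⟩
    obtain rfl : h = comp f g := E_ext fun t => (H t).trans (hJ.2.1.E_comp hJ.2.2.1).symm
    exact ⟨hJ, hG⟩
  · rintro ⟨hJ, hG⟩
    exact ⟨comp f g, ⟨hJ, hG⟩, fun t => hJ.2.1.E_comp hJ.2.2.1⟩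

end

/-- The case of lists of length one in `IsArrow.of_models`. -/
theorem IsArrow.of_models_one {P Q : Fml 1} {F : Fml 2}
    (h : ∀ (M : Type) [setLang.Structure M] [Nonempty M] [M ⊨ ZF],
      (∀ a b : M, Holds F ![a, b] → Holds P ![a] ∧ Holds Q ![b]) ∧
      (∀ a b b' : M, Holds F ![a, b] → Holds F ![a, b'] → b = b') ∧
      (∀ a : M, Holds P ![a] → ∃ b, Holds F ![a, b])) :
    IsArrow ⟨1, P⟩ ⟨1, Q⟩ F := by
  refine IsArrow.of_models fun M _ _ _ => ?_
  have e (x : Fin 1 → M) : x = ![x 0] := by funext i; fin_cases i; rfl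
  have e' (x y : Fin 1 → M) : Holds F (Fin.append x y : Fin 2 → M) ↔ Holds F ![x 0, y 0] := by
    rw [append_eq_cons]
  refine ⟨fun x y hxy => ?_, fun x y y' hy hy' => ?_, fun x hx => ?_⟩
  · have := (h M).1 _ _ ((e' x y).1 hxy)
    rwa [← e, ← e] at this
  · exact (e y).trans ((congrArg (fun b => ![b]) ((h M).2.1 _ _ _ ((e' x y).1 hy)
      ((e' x y').1 hy'))).trans (e y').symm)
  · obtain ⟨b, hb⟩ := (h M).2.2 (x 0) ((e x) ▸ hx)
    exact ⟨![b], (e' x ![b]).2 hb⟩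

/-! ### The six formulas define arrows -/

theorem isArrow_domFml : IsArrow SET₁ SET₀ domFml := IsArrow.of_models_one fun M _ _ _ => by
  simp only [holds_domFml]
  refine ⟨?_, ?_, ?_⟩
  · rintro _ _ ⟨f, z, h, -⟩
    exact ⟨(holds_SET₁ _).2 ⟨f, z, h⟩, rfl⟩
  · rintro _ _ _ ⟨f, z, ⟨rfl, -⟩, rfl⟩ ⟨f', z', ⟨h, -⟩, rfl⟩
    rw [(pair_inj.1 h).1]
  · rintro a ha
    obtain ⟨f, z, h⟩ := (holds_SET₁ _).1 ha
    exact ⟨_, f, z, h, rfl⟩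

theorem isArrow_codFml : IsArrow SET₁ SET₀ codFml := IsArrow.of_models_one fun M _ _ _ => by
  simp only [holds_codFml]
  refine ⟨?_, ?_, ?_⟩
  · rintro _ z ⟨f, h⟩
    exact ⟨(holds_SET₁ _).2 ⟨f, z, h⟩, rfl⟩
  · rintro _ _ _ ⟨f, rfl, -⟩ ⟨f', h, -⟩
    exact (pair_inj.1 h).2
  · rintro a ha
    obtain ⟨f, z, h⟩ := (holds_SET₁ _).1 ha
    exact ⟨z, f, h⟩

theorem isArrow_identFml : IsArrow SET₀ SET₁ identFml := IsArrow.of_models_one fun M _ _ _ => by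
  simp only [holds_identFml]
  refine ⟨?_, ?_, fun a _ => ⟨_, rfl⟩⟩
  · rintro x _ rfl
    exact ⟨rfl, (holds_SET₁ _).2 ⟨_, _, rfl, isMap_ident x⟩⟩
  · rintro _ _ _ rfl rfl
    rfl

theorem isArrow_fstFml : IsArrow SET₂ SET₁ fstFml := IsArrow.of_models_one fun M _ _ _ => by
  simp only [holds_fstFml]
  refine ⟨?_, ?_, ?_⟩
  · rintro _ _ ⟨f, g, z, h, rfl⟩
    exact ⟨(holds_SET₂ _).2 ⟨f, g, z, h⟩, (holds_SET₁ _).2 ⟨_, _, rfl, h.2.1⟩⟩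
  · rintro _ _ _ ⟨f, g, z, ⟨rfl, -⟩, rfl⟩ ⟨f', g', z', ⟨h, -⟩, rfl⟩
    rw [(pair_inj.1 h).1, (pair_inj.1 (pair_inj.1 h).2).1]
  · rintro a ha
    obtain ⟨f, g, z, h⟩ := (holds_SET₂ _).1 ha
    exact ⟨_, f, g, z, h, rfl⟩

theorem isArrow_sndFml : IsArrow SET₂ SET₁ sndFml := IsArrow.of_models_one fun M _ _ _ => by
  simp only [holds_sndFml]
  refine ⟨?_, ?_, ?_⟩
  · rintro _ _ ⟨f, g, z, h, rfl⟩
    exact ⟨(holds_SET₂ _).2 ⟨f, g, z, h⟩, (holds_SET₁ _).2 ⟨_, _, rfl, h.2.2⟩⟩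
  · rintro _ _ _ ⟨f, g, z, ⟨rfl, -⟩, rfl⟩ ⟨f', g', z', ⟨h, -⟩, rfl⟩
    exact (pair_inj.1 h).2
  · rintro a ha
    obtain ⟨f, g, z, h⟩ := (holds_SET₂ _).1 ha
    exact ⟨_, f, g, z, h, rfl⟩

theorem isArrow_boxFml : IsArrow SET₂ SET₁ boxFml := IsArrow.of_models_one fun M _ _ _ => by
  simp only [holds_boxFml]
  refine ⟨?_, ?_, ?_⟩
  · rintro _ _ ⟨f, g, z, h, rfl⟩
    exact ⟨(holds_SET₂ _).2 ⟨f, g, z, h⟩, (holds_SET₁ _).2 ⟨_, _, rfl, h.2.1.comp h.2.2⟩⟩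
  · rintro _ _ _ ⟨f, g, z, ⟨rfl, -⟩, rfl⟩ ⟨f', g', z', ⟨h, -⟩, rfl⟩
    rw [(pair_inj.1 h).1, (pair_inj.1 (pair_inj.1 h).2).1, (pair_inj.1 (pair_inj.1 h).2).2]
  · rintro a ha
    obtain ⟨f, g, z, h⟩ := (holds_SET₂ _).1 ha
    exact ⟨_, f, g, z, h, rfl⟩

/-! ### Points of the three objects and the values of the arrows on them -/

section

variable {M : Type} [setLang.Structure M] [Nonempty M] [M ⊨ ZF]

/-- The point of `SET₀` given by a set. -/
def objPt (x : M) : Pts M SET₀ := ⟨![x], rfl⟩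

/-- The point of `SET₁` given by a function and a codomain. -/
noncomputable def mapPt (f z : M) (h : IsMap f z) : Pts M SET₁ :=
  ⟨![pair f z], (holds_SET₁ _).2 ⟨f, z, rfl, h⟩⟩

/-- The point of `SET₂` given by two composable functions and a codomain. -/
noncomputable def compPt (f g z : M) (hf : IsMap f (dom g)) (hg : IsMap g z) : Pts M SET₂ :=
  ⟨![pair f (pair g z)], (holds_SET₂ _).2 ⟨f, g, z, rfl, hf, hg⟩⟩

omit [Nonempty M] [M ⊨ ZF] in
theorem exists_eq_objPt (p : Pts M SET₀) : ∃ x, p = objPt x := by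
  refine ⟨p.1 (0 : Fin 1), Subtype.ext (funext fun i => ?_)⟩
  change Fin 1 at i
  fin_cases i
  rfl

omit [Nonempty M] in
theorem exists_eq_mapPt (p : Pts M SET₁) : ∃ f z h, p = mapPt f z h := by
  obtain ⟨f, z, e, h⟩ := (holds_SET₁ p.1).1 p.2
  refine ⟨f, z, h, Subtype.ext (funext fun i => ?_)⟩
  change Fin 1 at i
  fin_cases i
  exact e

theorem exists_eq_compPt (p : Pts M SET₂) : ∃ f g z hf hg, p = compPt f g z hf hg := by
  obtain ⟨f, g, z, e, hf, hg⟩ := (holds_SET₂ p.1).1 p.2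
  refine ⟨f, g, z, hf, hg, Subtype.ext (funext fun i => ?_)⟩
  change Fin 1 at i
  fin_cases i
  exact e

omit [Nonempty M] [M ⊨ ZF] in
theorem objPt_inj {x y : M} (h : objPt x = objPt y) : x = y :=
  congrFun (congrArg Subtype.val h) (0 : Fin 1)

omit [Nonempty M] in
theorem mapPt_inj {f z f' z' : M} {h : IsMap f z} {h' : IsMap f' z'}
    (e : mapPt f z h = mapPt f' z' h') : f = f' ∧ z = z' :=
  pair_inj.1 (congrFun (congrArg Subtype.val e) (0 : Fin 1))

theorem ev_arrow_one {P Q : Fml 1} {F : Fml 2} (hF : IsArrow ⟨1, P⟩ ⟨1, Q⟩ F) {a b : M}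
    (ha : Holds P ![a]) (hb : Holds Q ![b]) (h : Holds F ![a, b]) :
    ev (arrow hF) (⟨![a], ha⟩ : Pts M ⟨1, P⟩) = ⟨![b], hb⟩ := by
  refine ev_arrow_eq_iff.2 ?_
  change Holds F (Fin.append ![a] ![b] : Fin 2 → M)
  rwa [append_eq_cons]

theorem ev_dom (f z : M) (h : IsMap f z) :
    ev (arrow isArrow_domFml) (mapPt f z h) = objPt (dom f) :=
  ev_arrow_one isArrow_domFml _ _ ((holds_domFml _ _).2 ⟨f, z, ⟨rfl, h⟩, rfl⟩)

theorem ev_cod (f z : M) (h : IsMap f z) :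
    ev (arrow isArrow_codFml) (mapPt f z h) = objPt z :=
  ev_arrow_one isArrow_codFml _ _ ((holds_codFml _ _).2 ⟨f, rfl, h⟩)

theorem ev_ident (x : M) :
    ev (arrow isArrow_identFml) (objPt x) = mapPt (ident x) x (isMap_ident x) :=
  ev_arrow_one isArrow_identFml _ _ ((holds_identFml _ _).2 rfl)

theorem ev_fst (f g z : M) (hf : IsMap f (dom g)) (hg : IsMap g z) :
    ev (arrow isArrow_fstFml) (compPt f g z hf hg) = mapPt f (dom g) hf :=
  ev_arrow_one isArrow_fstFml _ _ ((holds_fstFml _ _).2 ⟨f, g, z, ⟨rfl, hf, hg⟩, rfl⟩)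

theorem ev_snd (f g z : M) (hf : IsMap f (dom g)) (hg : IsMap g z) :
    ev (arrow isArrow_sndFml) (compPt f g z hf hg) = mapPt g z hg :=
  ev_arrow_one isArrow_sndFml _ _ ((holds_sndFml _ _).2 ⟨f, g, z, ⟨rfl, hf, hg⟩, rfl⟩)

theorem ev_box (f g z : M) (hf : IsMap f (dom g)) (hg : IsMap g z) :
    ev (arrow isArrow_boxFml) (compPt f g z hf hg) = mapPt (comp f g) z (hf.comp hg) :=
  ev_arrow_one isArrow_boxFml _ _ ((holds_boxFml _ _).2 ⟨f, g, z, ⟨rfl, hf, hg⟩, rfl⟩)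

omit [Nonempty M] in
theorem mapPt_congr {f g z : M} (h : f = g) (hf : IsMap f z) (hg : IsMap g z) :
    mapPt f z hf = mapPt g z hg := by
  subst h
  rfl

end

/-! ### The axioms of an internal category -/

theorem isPullback_SET₂ : IsPullback (arrow isArrow_fstFml) (arrow isArrow_sndFml)
    (arrow isArrow_codFml) (arrow isArrow_domFml) := by
  refine isPullback_of_models (fun M _ _ _ p => ?_) (fun M _ _ _ a b h => ?_)
    fun M _ _ _ p p' h1 h2 => ?_
  · obtain ⟨f, g, z, hf, hg, rfl⟩ := exists_eq_compPt p
    rw [ev_fst, ev_snd, ev_cod, ev_dom]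
  -- The codomain `y` of the first map equals `dom g`, so the code `⟨f, ⟨g, z⟩⟩` can omit it and
  -- still determines both maps.
  · obtain ⟨f, y, hf, rfl⟩ := exists_eq_mapPt a
    obtain ⟨g, z, hg, rfl⟩ := exists_eq_mapPt b
    rw [ev_cod, ev_dom] at h
    obtain rfl := objPt_inj h
    exact ⟨compPt f g z hf hg, ev_fst _ _ _ _ _, ev_snd _ _ _ _ _⟩
  · obtain ⟨f, g, z, hf, hg, rfl⟩ := exists_eq_compPt p
    obtain ⟨f', g', z', hf', hg', rfl⟩ := exists_eq_compPt p'
    rw [ev_fst, ev_fst] at h1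
    rw [ev_snd, ev_snd] at h2
    obtain ⟨rfl, -⟩ := mapPt_inj h1
    obtain ⟨rfl, rfl⟩ := mapPt_inj h2
    rfl

theorem ident_cod : arrow isArrow_identFml ≫ arrow isArrow_codFml = 𝟙 SET₀ :=
  hom_ext_of_models fun M _ _ _ p => by
    obtain ⟨x, rfl⟩ := exists_eq_objPt p
    rw [ev_comp, ev_ident, ev_cod, ev_id]

theorem ident_dom : arrow isArrow_identFml ≫ arrow isArrow_domFml = 𝟙 SET₀ :=
  hom_ext_of_models fun M _ _ _ p => by
    obtain ⟨x, rfl⟩ := exists_eq_objPt p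
    rw [ev_comp, ev_ident, ev_dom, ev_id, dom_ident]

theorem box_dom : arrow isArrow_boxFml ≫ arrow isArrow_domFml =
    arrow isArrow_fstFml ≫ arrow isArrow_domFml :=
  hom_ext_of_models fun M _ _ _ p => by
    obtain ⟨f, g, z, hf, hg, rfl⟩ := exists_eq_compPt p
    rw [ev_comp, ev_comp, ev_box, ev_fst, ev_dom, ev_dom, hf.dom_comp hg]

theorem box_cod : arrow isArrow_boxFml ≫ arrow isArrow_codFml =
    arrow isArrow_sndFml ≫ arrow isArrow_codFml :=
  hom_ext_of_models fun M _ _ _ p => by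
    obtain ⟨f, g, z, hf, hg, rfl⟩ := exists_eq_compPt p
    rw [ev_comp, ev_comp, ev_box, ev_snd, ev_cod, ev_cod]

/-- The arrow into the pullback is known only through its projections. They determine its value at a
point, so composing with it is computed by composing functions in the model. -/
theorem ev_lift_box {M : Type} [setLang.Structure M] [Nonempty M] [M ⊨ ZF] {X : ZFCat}
    {a b : X ⟶ SET₁} (w : a ≫ arrow isArrow_codFml = b ≫ arrow isArrow_domFml) {p : Pts M X}
    {f y g z : M} {hf : IsMap f y} {hg : IsMap g z} (h1 : ev a p = mapPt f y hf)
    (h2 : ev b p = mapPt g z hg) : ∃ h : IsMap f (dom g), y = dom g ∧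
      ev (isPullback_SET₂.lift a b w ≫ arrow isArrow_boxFml) p =
        mapPt (comp f g) z (h.comp hg) := by
  rw [← isPullback_SET₂.lift_fst a b w, ev_comp] at h1
  rw [← isPullback_SET₂.lift_snd a b w, ev_comp] at h2
  rw [ev_comp]
  obtain ⟨f', g', z', hf', hg', e⟩ := exists_eq_compPt (ev (isPullback_SET₂.lift a b w) p)
  rw [e] at h1 h2 ⊢
  rw [ev_fst] at h1
  rw [ev_snd] at h2
  obtain ⟨rfl, rfl⟩ := mapPt_inj h1
  obtain ⟨rfl, rfl⟩ := mapPt_inj h2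
  exact ⟨hf', rfl, ev_box _ _ _ _ _⟩

/-- The sets and functions form an internal category of the syntactic category of ZF. -/
theorem isInternalCategory_SET : IsInternalCategory (arrow isArrow_domFml) (arrow isArrow_codFml)
    (arrow isArrow_identFml) (arrow isArrow_fstFml) (arrow isArrow_sndFml)
    (arrow isArrow_boxFml) where
  isPullback := isPullback_SET₂
  id_cod := ident_cod
  id_dom := ident_dom
  comp_dom := box_dom
  comp_cod := box_cod
  id_comp := hom_ext_of_models fun M _ _ _ p => by
    obtain ⟨f, z, h, rfl⟩ := exists_eq_mapPt p
    have h1 : ev (arrow isArrow_domFml ≫ arrow isArrow_identFml) (mapPt f z h) =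
        mapPt _ _ (isMap_ident (dom f)) := by rw [ev_comp, ev_dom, ev_ident]
    obtain ⟨_, -, e⟩ := ev_lift_box (by simp [ident_cod]) h1 (ev_id (mapPt f z h))
    rw [ev_id]
    exact e.trans (mapPt_congr h.ident_comp _ _)
  comp_id := hom_ext_of_models fun M _ _ _ p => by
    obtain ⟨f, z, h, rfl⟩ := exists_eq_mapPt p
    have h2 : ev (arrow isArrow_codFml ≫ arrow isArrow_identFml) (mapPt f z h) =
        mapPt _ _ (isMap_ident z) := by rw [ev_comp, ev_cod, ev_ident]
    obtain ⟨_, -, e⟩ := ev_lift_box (by simp [ident_dom]) (ev_id (mapPt f z h)) h2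
    rw [ev_id]
    exact e.trans (mapPt_congr h.comp_ident _ _)
  hasTriples := hasPullback _ _
  assoc {T} q₀ q₁ h := hom_ext_of_models fun M _ _ _ p => by
    obtain ⟨f, g, y, hf, hg, e0⟩ := exists_eq_compPt (ev q₀ p)
    obtain ⟨k, z, hk, e1⟩ := exists_eq_mapPt (ev q₁ p)
    have box0 : ev (q₀ ≫ arrow isArrow_boxFml) p = mapPt _ _ (hf.comp hg) := by
      rw [ev_comp, e0, ev_box]
    have fst0 : ev (q₀ ≫ arrow isArrow_fstFml) p = mapPt _ _ hf := by rw [ev_comp, e0, ev_fst]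
    have snd0 : ev (q₀ ≫ arrow isArrow_sndFml) p = mapPt _ _ hg := by rw [ev_comp, e0, ev_snd]
    -- Besides the value of the left-hand side, this identifies the codomain of `g` with `dom k`,
    -- the hypothesis under which composition of `f`, `g`, `k` is associative. Only the values of
    -- `q₀` and `q₁` at `p` enter, so any choice of the pullback `T` is covered.
    obtain ⟨_, rfl, e⟩ := ev_lift_box (by simpa using h.w) box0 e1
    obtain ⟨_, -, e'⟩ := ev_lift_box (by simpa [box_cod] using h.w) snd0 e1
    obtain ⟨_, -, e''⟩ := ev_lift_box (by simp [box_dom, isPullback_SET₂.w]) fst0 e'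
    exact e.trans ((mapPt_congr (hf.comp_assoc hg hk) _ _).trans e''.symm)

end ZFSyn

/-- The assignments `SET₀`, `SET₁`, `δ₀`, `δ₁`, `ID`, `□` define objects and arrows of the syntactic
category of ZF, and they form an internal category there, with `SET₂` as the object of composable
arrows. -/
theorem mainTheorem4 :
    ∃ (hδ₀ : ZFSyn.IsArrow ZFSyn.SET₁ ZFSyn.SET₀ ZFSyn.domFml)
      (hδ₁ : ZFSyn.IsArrow ZFSyn.SET₁ ZFSyn.SET₀ ZFSyn.codFml)
      (hID : ZFSyn.IsArrow ZFSyn.SET₀ ZFSyn.SET₁ ZFSyn.identFml)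
      (hp₀ : ZFSyn.IsArrow ZFSyn.SET₂ ZFSyn.SET₁ ZFSyn.fstFml)
      (hp₁ : ZFSyn.IsArrow ZFSyn.SET₂ ZFSyn.SET₁ ZFSyn.sndFml)
      (hbox : ZFSyn.IsArrow ZFSyn.SET₂ ZFSyn.SET₁ ZFSyn.boxFml),
      ZFSyn.IsInternalCategory (ZFSyn.arrow hδ₀) (ZFSyn.arrow hδ₁) (ZFSyn.arrow hID)
        (ZFSyn.arrow hp₀) (ZFSyn.arrow hp₁) (ZFSyn.arrow hbox) :=
  ⟨ZFSyn.isArrow_domFml, ZFSyn.isArrow_codFml, ZFSyn.isArrow_identFml, ZFSyn.isArrow_fstFml,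
    ZFSyn.isArrow_sndFml, ZFSyn.isArrow_boxFml, ZFSyn.isInternalCategory_SET⟩
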